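/- Let $n\ge 0$. A permutation $\sigma=\sigma_1\cdots\sigma_n$ of $[n]$ is \emph{simsun} if for every $k$ the subword of $\sigma$ formed by the letters $\le k$ has no three consecutive decreasing letters. Let $\mathcal{RS}_n$ be the set of simsun permutations of $[n]$ and $\mathcal{RS}_n(\omega)$ the set of those that avoid the pattern $\omega$. Let $\mathcal T_n$ be the set of rooted trees on $\{0,1,\dots,n\}$ whose labels increase along every path from the root and in which every vertex has at most two children (the order of the children is irrelevant). Draw such a tree so that of two siblings the larger is the left child, and an only child is a right child; $\tau(x)$ denotes the subtree formed by $x$ and its descendants. The word $\phi(T)$ is defined recursively: it is empty if $T$ is a single vertex; if the root has one child $x$, then $\phi(T)=x\,\phi(\tau(x))$; if the root has children $u>v$, then $\phi(T)=\omega\,\phi(T-\tau(u))$, where $\omega$ is the inorder word of $\tau(u)$ (left subtree, root, right subtree). Let $\mathcal X_n$ be the set of ordered trees with $n+1$ vertices in which every vertex has at most two children, with the vertices labelled $0,1,\dots,n$ in right-to-left preorder (root, right subtree, left subtree). Let $\mathcal F_n$ be the set of all $T\in\mathcal T_n$ with $\phi(T)\in\mathcal{RS}_n(231)$. For $T\in\mathcal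 F_n$ let $\psi(T)$ be the result of the following process, repeated until the labels are increasing in right-to-left preorder: find the first pair $(v,z)$ of consecutive vertices in right-to-left preorder with $z\ge v+2$, and move the subtrees hanging from $v$ (that is, $\tau(z)$ and, if $v$ has a left child $y$, also $\tau(y)$) to the leaf $z-1$, keeping left and right. A Motzkin path of length $n$ is a lattice path from $(0,0)$ to $(n,0)$ with steps $U=(1,1)$, $L=(1,0)$, $D=(1,-1)$ that never passes below the $x$-axis; let $\mathcal M_n$ be the set of these paths. For an ordered tree $T$ as above, the word $\chi(T)$ is empty if $T$ is a single vertex, $\chi(T)=L\,\chi(\tau(x))$ if the root has one child $x$, and $\chi(T)=U\,\chi(\tau(v))\,D\,\chi(\tau(u))$ if the root has left child $u$ and right child $v$. Then: (1) $\phi$ is a bijection from $\mathcal T_n$ onto $\mathcal{RS}_n$; (2) the process defining $\psi$ terminates on $\mathcal F_n$, and $\psi$ is a bijection from $\mathcal F_n$ onto $\mathcal X_n$; (3) $\phi\circ\psi\circ\phi^{-1}$ is a bijection from $\mathcal{RS}_n(231)$ onto $\mathcal{RS}_n(213)$; (4) $\chi\circ\psi\circ\phi^{-1}$ is a bijection from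 $\mathcal{RS}_n(231)$ onto $\mathcal M_n$. -/

import Mathlib

open Set

namespace Simsun

/-! ### Simsun permutations and pattern avoidance -/

/-- The one-line notation `σ₁ σ₂ ⋯ σₙ`, a word with letters in `{1, …, n}`
(the `i`-th entry of `Fin n` stands for the number `i + 1`). -/
def oneLine {n : ℕ} (σ : Equiv.Perm (Fin n)) : List ℕ :=
  List.ofFn fun i => (σ i : ℕ) + 1

/-- The word `w` has a double descent: three consecutive letters `a > b > c`. -/
def HasDoubleDescent (w : List ℕ) : Prop :=
  ∃ a b c : ℕ, [a, b, c] <:+: w ∧ b < a ∧ c < b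

/-- `σ` is simsun: for every `k`, the subword of `σ` restricted to `{1, …, k}` has no
double descents. -/
def IsSimsun {n : ℕ} (σ : Equiv.Perm (Fin n)) : Prop :=
  ∀ k : ℕ, ¬ HasDoubleDescent ((oneLine σ).filter (· ≤ k))

/-- `σ` contains the pattern `ω = ω₁ ⋯ ωₜ`: there are indices `i₁ < ⋯ < iₜ` with
`σ_{i_j} < σ_{i_k}` if and only if `ω_j < ω_k`. -/
def ContainsPattern {n t : ℕ} (σ : Equiv.Perm (Fin n)) (ω : Fin t → ℕ) : Prop :=
  ∃ i : Fin t → Fin n, StrictMono i ∧ ∀ j k, σ (i j) < σ (i k) ↔ ω j < ω k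

/-- The set of simsun permutations of `[n]`. -/
def RS (n : ℕ) : Set (Equiv.Perm (Fin n)) :=
  {σ | IsSimsun σ}

/-- The set of `ω`-avoiding simsun permutations of `[n]`. -/
def RSAvoid (n : ℕ) {t : ℕ} (ω : Fin t → ℕ) : Set (Equiv.Perm (Fin n)) :=
  {σ | IsSimsun σ ∧ ¬ ContainsPattern σ ω}

/-! ### Trees -/

/-- Vertex-labelled plane rooted trees in which every vertex has at most two children. An only
child counts as a right child; `two a l r` has left subtree `l` and right subtree `r`. -/
inductive Tree12 : Type
  | leaf (a : ℕ) : Tree12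
  | one (a : ℕ) (c : Tree12) : Tree12
  | two (a : ℕ) (l r : Tree12) : Tree12

namespace Tree12

instance : Inhabited Tree12 := ⟨leaf 0⟩

/-- The label of the root. -/
def root : Tree12 → ℕ
  | leaf a => a
  | one a _ => a
  | two a _ _ => a

/-- Right-to-left preorder: the root, then the right subtree, then the left subtree. -/
def preorder : Tree12 → List ℕ
  | leaf a => [a]
  | one a c => a :: preorder c
  | two a l r => a :: (preorder r ++ preorder l)

/-- Inorder: the left subtree (possibly empty), the root, then the right subtree. -/
def inorder : Tree12 → List ℕ
  | leaf a => [a]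
  | one a c => a :: inorder c
  | two a l r => inorder l ++ a :: inorder r

/-- Labels increase along every path from the root, and the tree is in canonical form: when a
vertex has two children, the left child is the larger one. -/
def IsIncreasing : Tree12 → Prop
  | leaf _ => True
  | one a c => a < c.root ∧ IsIncreasing c
  | two a l r => a < r.root ∧ r.root < l.root ∧ IsIncreasing l ∧ IsIncreasing r

/-- The subtree `τ(x)` of the vertex labelled `x`, if there is such a vertex. -/
def subtree (x : ℕ) : Tree12 → Option Tree12
  | leaf a => if a = x then some (leaf a) else none
  | one a c => if a = x then some (one a c) else subtree x c
  | two a l r => if a = x then some (two a l r) else (subtree x l).or (subtree x r)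

/-- Replace the subtree `τ(x)` by `S`. -/
def replace (x : ℕ) (S : Tree12) : Tree12 → Tree12
  | leaf a => if a = x then S else leaf a
  | one a c => if a = x then S else one a (replace x S c)
  | two a l r => if a = x then S else two a (replace x S l) (replace x S r)

end Tree12

open Tree12

/-- Increasing 1-2 trees on `{0, 1, …, n}`. The order of the subtrees of a vertex is irrelevant,
so each tree is represented by its canonical form. -/
def IncTrees (n : ℕ) : Set Tree12 :=
  {T | T.IsIncreasing ∧ T.preorder.Perm (List.range (n + 1))}

/-- Ordered 1-2 trees with `n + 1` vertices, each one labelled by `0, 1, …, n` in right-to-left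
preorder (every shape has exactly one such labelling). -/
def OrdTrees (n : ℕ) : Set Tree12 :=
  {T | T.preorder = List.range (n + 1)}

/-! ### The map `φ` -/

/-- The word `φ(T)`. If the root has one child `c`, write its label and continue with `τ(c)`.
If the root has two children, write the inorder word of the left subtree and continue with the
tree that is left when the left subtree is removed (see `phi_two`). -/
def phi : Tree12 → List ℕ
  | leaf _ => []
  | one _ c => c.root :: phi c
  | two _ l r => l.inorder ++ r.root :: phi r

theorem phi_two (a : ℕ) (l r : Tree12) : phi (two a l r) = l.inorder ++ phi (one a r) := rfl

/-- The inverse of `φ`, from words of simsun permutations of `[n]` to increasing 1-2 trees on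
`{0, 1, …, n}`. -/
noncomputable def phiInv (n : ℕ) : List ℕ → Tree12 :=
  Function.invFunOn phi (IncTrees n)

/-- The increasing 1-2 trees that correspond under `φ` to `231`-avoiding simsun permutations. -/
def Trees231 (n : ℕ) : Set Tree12 :=
  {T ∈ IncTrees n | ∃ σ ∈ RSAvoid n ![2, 3, 1], phi T = oneLine σ}

/-! ### The map `ψ` -/

/-- The first pair `(v, z)` of consecutive letters with `z ≥ v + 2`. -/
def firstGap : List ℕ → Option (ℕ × ℕ)
  | v :: z :: w => if v + 2 ≤ z then some (v, z) else firstGap (z :: w)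
  | _ => none

/-- Move the subtrees of the children of the vertex `v` to the leaf `x`, keeping left and
right. -/
def switchSubtrees (v x : ℕ) (T : Tree12) : Tree12 :=
  match T.subtree v with
  | some (one _ c) => replace x (one x c) (replace v (leaf v) T)
  | some (two _ l r) => replace x (two x l r) (replace v (leaf v) T)
  | _ => T

/-- One round of the switching process: find the first pair `(v, z)` of consecutive vertices in
right-to-left preorder with `z ≥ v + 2`, and move the subtrees of the children of `v` (namely
`z` and, if present, its sibling) to the leaf `z - 1`. -/
def switchRound (T : Tree12) : Tree12 :=
  match firstGap T.preorder with
  | some (v, z) => switchSubtrees v (z - 1) T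
  | none => T

/-- The map `ψ`: rounds of switching are performed until, for the first time, the vertices are
increasing in right-to-left preorder. (Should this never happen, the value is `T` itself.) -/
noncomputable def psi (T : Tree12) : Tree12 :=
  switchRound^[sInf {k : ℕ | (switchRound^[k] T).preorder.Pairwise (· < ·)}] T

/-! ### Motzkin paths and the map `χ` -/

/-- The up step `(1, 1)`, the level step `(1, 0)` and the down step `(1, -1)`. -/
inductive Step : Type
  | U : Step
  | L : Step
  | D : Step

/-- The vertical displacement of a step. -/
def Step.rise : Step → ℤ
  | Step.U => 1
  | Step.L => 0
  | Step.D => -1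

/-- Motzkin paths of length `n`: lattice paths from `(0, 0)` to `(n, 0)` that never pass below
the `x`-axis, as words of steps. -/
def MotzkinPaths (n : ℕ) : Set (List Step) :=
  {p | p.length = n ∧ (p.map Step.rise).sum = 0 ∧
    ∀ k : ℕ, 0 ≤ ((p.take k).map Step.rise).sum}

/-- The word `χ(T)`. -/
def chi : Tree12 → List Step
  | leaf _ => []
  | one _ c => Step.L :: chi c
  | two _ l r => Step.U :: (chi r ++ Step.D :: chi l)

end Simsun

/-! Bijectivity of `φ`. Both `φ` and inorder split a word `A v B` at its smallest letter, which
determines the split and hence the tree. The simsun condition respects these splits. For `φ` it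
decouples into `A v` and `B` (`simsunWord_append_cons`). For an inorder word followed by a smaller
letter it also demands that, if `A` is nonempty, the minimum of `B` is at most that of `A`
(`simsunWord_append_cons_append`). This is exactly the canonical form: no lone left child, and the
right sibling is the smaller one.

Avoidance of 213 at such a split says that no letter of `B` exceeds a letter of `A`. Recursively
this means that the right-to-left preorder is increasing, so `φ` maps `OrdTrees n` onto the words of
`RS_n(213)`.

Avoidance of 231 forces every left child to be a leaf, so `Trees231 n` consists of caterpillars. An
ordered tree `S` has the caterpillar `cat 0 (code S)`: its spine lists the only and right children
of `S` in preorder, each carrying its left sibling as a leaf. Every tree in `Trees231 n` arises so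
(`exists_cat_code_eq`), because 231-avoidance places the labels below a left sibling `u` before
those above it, which recovers the right and the left subtree.

`ψ` rebuilds `S` from its caterpillar. At each stage the vertices already passed are placed as in
`S`, the left siblings still waiting are bare leaves, and all their codes hang in one caterpillar at
the current vertex. When the current vertex is a leaf of `S`, one round moves this caterpillar to
the next left sibling that is not a leaf of `S` (`switchRound_fill`). Hence `ψ` inverts `S ↦ cat 0
(code S)`.

Finally, `χ` is the first-return decomposition of Motzkin paths, and the remaining bijections are
composites. -/

namespace Simsun
open Tree12

/-! ### Labels of increasing trees -/

theorem root_mem_preorder (T : Tree12) : T.root ∈ T.preorder := by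
  cases T <;> simp [root, preorder]

theorem inorder_perm_preorder (T : Tree12) : T.inorder.Perm T.preorder := by
  induction T with
  | leaf a => simp [inorder, preorder]
  | one a c ih => simpa [inorder, preorder] using ih
  | two a l r ihl ihr =>
    simp only [inorder, preorder]
    refine List.perm_middle.trans (List.Perm.cons _ ?_)
    exact (ihl.append ihr).trans List.perm_append_comm

theorem root_cons_phi_perm_preorder (T : Tree12) : (T.root :: phi T).Perm T.preorder := by
  induction T with
  | leaf a => simp [root, phi, preorder]
  | one a c ih => simpa [root, phi, preorder] using ih
  | two a l r ihl ihr =>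
    simp only [root, phi, preorder]
    refine List.Perm.cons _ ?_
    exact ((inorder_perm_preorder l).append ihr).trans List.perm_append_comm

theorem mem_inorder {T : Tree12} {x : ℕ} : x ∈ T.inorder ↔ x ∈ T.preorder :=
  (inorder_perm_preorder T).mem_iff

theorem root_mem_inorder (T : Tree12) : T.root ∈ T.inorder :=
  mem_inorder.2 (root_mem_preorder T)

theorem inorder_ne_nil (T : Tree12) : T.inorder ≠ [] :=
  List.ne_nil_of_mem (root_mem_inorder T)

theorem root_le_of_mem {T : Tree12} (h : T.IsIncreasing) {x : ℕ} (hx : x ∈ T.preorder) :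
    T.root ≤ x := by
  induction T with
  | leaf a => simp_all [root, preorder]
  | one a c ih =>
    simp only [IsIncreasing, preorder, List.mem_cons, root] at *
    rcases hx with rfl | hx
    · exact le_rfl
    · have := ih h.2 hx; omega
  | two a l r ihl ihr =>
    simp only [IsIncreasing, preorder, List.mem_cons, List.mem_append, root] at *
    rcases hx with rfl | hx | hx
    · exact le_rfl
    · have := ihr h.2.2.2 hx; omega
    · have := ihl h.2.2.1 hx; omega

/-! ### Words without double descents -/

theorem hasDoubleDescent_cons {x : ℕ} {w : List ℕ} :
    HasDoubleDescent (x :: w) ↔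
      (∃ b c t, w = b :: c :: t ∧ b < x ∧ c < b) ∨ HasDoubleDescent w := by
  constructor
  · rintro ⟨a, b, c, h, hb, hc⟩
    rcases List.infix_cons_iff.1 h with h | h
    · obtain ⟨t, ht⟩ := h
      simp only [List.cons_append, List.nil_append, List.cons.injEq] at ht
      obtain ⟨rfl, rfl⟩ := ht
      exact Or.inl ⟨b, c, t, rfl, hb, hc⟩
    · exact Or.inr ⟨a, b, c, h, hb, hc⟩
  · rintro (⟨b, c, t, rfl, hb, hc⟩ | ⟨a, b, c, h, hb, hc⟩)
    · exact ⟨x, b, c, ⟨[], t, rfl⟩, hb, hc⟩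
    · exact ⟨a, b, c, h.trans (List.infix_cons (List.infix_refl w)), hb, hc⟩

theorem not_hasDoubleDescent_nil : ¬ HasDoubleDescent [] := by
  rintro ⟨a, b, c, h, -, -⟩
  simp at h

theorem not_hasDoubleDescent_singleton (x : ℕ) : ¬ HasDoubleDescent [x] := by
  rw [hasDoubleDescent_cons]
  simp [not_hasDoubleDescent_nil]

/-- A double descent cannot straddle the ascent `v < b`. -/
theorem hasDoubleDescent_append_cons_cons {A B : List ℕ} {v b : ℕ} (hb : v < b) :
    HasDoubleDescent (A ++ v :: b :: B) ↔
      HasDoubleDescent (A ++ [v]) ∨ HasDoubleDescent (b :: B) := by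
  induction A with
  | nil =>
    rw [List.nil_append, List.nil_append, hasDoubleDescent_cons]
    have := not_hasDoubleDescent_singleton v
    constructor
    · rintro (⟨b', c, t, h, hb', -⟩ | h)
      · simp only [List.cons.injEq] at h
        omega
      · exact Or.inr h
    · tauto
  | cons x A ih =>
    rw [List.cons_append, List.cons_append, hasDoubleDescent_cons, hasDoubleDescent_cons, ih,
      ← or_assoc]
    refine or_congr_left (or_congr_left ?_)
    match A with
    | [] =>
      constructor
      · rintro ⟨b', c, t, h, hb', hc⟩
        simp only [List.nil_append, List.cons.injEq] at h
        omega
      · rintro ⟨b', c, t, h, hb', hc⟩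
        simp at h
    | [y] => simp
    | y :: z :: A => simp

theorem hasDoubleDescent_append_cons {A B : List ℕ} {v : ℕ} (hB : ∀ y ∈ B, v < y) :
    HasDoubleDescent (A ++ v :: B) ↔ HasDoubleDescent (A ++ [v]) ∨ HasDoubleDescent B := by
  rcases B with _ | ⟨b, B⟩
  · simp [not_hasDoubleDescent_nil]
  · exact hasDoubleDescent_append_cons_cons (hB b (by simp))

theorem hasDoubleDescent_append_pair {A : List ℕ} {a m : ℕ} (hA : ∀ y ∈ A, a < y) (hm : m < a) :
    HasDoubleDescent (A ++ [a, m]) ↔ A ≠ [] := by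
  induction A with
  | nil =>
    rw [List.nil_append, hasDoubleDescent_cons]
    simp [not_hasDoubleDescent_singleton]
  | cons x A ih =>
    rw [List.cons_append, hasDoubleDescent_cons, ih fun y hy => hA y (by simp [hy])]
    simp only [ne_eq, reduceCtorEq, not_false_eq_true, iff_true]
    by_cases h : A = []
    · subst h
      exact Or.inl ⟨a, m, [], rfl, hA x (by simp), hm⟩
    · exact Or.inr h

/-- The word `w` is simsun: no restriction of `w` to small letters has a double descent. -/
def SimsunWord (w : List ℕ) : Prop :=
  ∀ k : ℕ, ¬ HasDoubleDescent (w.filter (· ≤ k))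

theorem simsunWord_nil : SimsunWord [] := fun _ => by simpa using not_hasDoubleDescent_nil

theorem filter_le_eq_nil {A : List ℕ} {k v : ℕ} (h : ∀ y ∈ A, v < y) (hk : k < v) :
    A.filter (· ≤ k) = [] := by
  simp only [List.filter_eq_nil_iff, decide_eq_true_eq, not_le]
  intro y hy
  have := h y hy
  omega

theorem filter_le_lt {A : List ℕ} {k v : ℕ} (h : ∀ y ∈ A, v < y) :
    ∀ y ∈ A.filter (· ≤ k), v < y := fun y hy => h y (List.mem_of_mem_filter hy)

/-- A restriction either erases everything or keeps the minimum `v`, which is then followed by an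
ascent or by nothing. -/
theorem simsunWord_append_cons {A B : List ℕ} {v : ℕ} (hA : ∀ y ∈ A, v < y)
    (hB : ∀ y ∈ B, v < y) :
    SimsunWord (A ++ v :: B) ↔ SimsunWord (A ++ [v]) ∧ SimsunWord B := by
  rw [SimsunWord, SimsunWord, SimsunWord, ← forall_and]
  refine forall_congr' fun k => ?_
  rw [← not_or]
  refine not_congr ?_
  by_cases hk : v ≤ k
  · simp only [List.filter_append, List.filter_cons, hk, decide_true, if_true, List.filter_nil]
    exact hasDoubleDescent_append_cons (filter_le_lt hB)
  · simp only [List.filter_append, List.filter_cons, hk, decide_false, List.filter_nil,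
      filter_le_eq_nil hA (not_le.1 hk), filter_le_eq_nil hB (not_le.1 hk)]
    simp [not_hasDoubleDescent_nil]

/-- If the restriction to letters at most `k` empties `B` but not `A`, the last surviving letter of
`A` forms a double descent with `a` and `m`. Taking `k = x` for `x ∈ A` gives the last clause. -/
theorem simsunWord_append_cons_append {A B : List ℕ} {a m : ℕ} (hA : ∀ y ∈ A, a < y)
    (hB : ∀ y ∈ B, a < y) (hm : m < a) :
    SimsunWord (A ++ a :: (B ++ [m])) ↔
      SimsunWord (A ++ [a]) ∧ SimsunWord (B ++ [m]) ∧ ∀ x ∈ A, ∃ y ∈ B, y ≤ x := by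
  have key : ∀ k, ¬ HasDoubleDescent ((A ++ a :: (B ++ [m])).filter (· ≤ k)) ↔
      ¬ HasDoubleDescent ((A ++ [a]).filter (· ≤ k)) ∧
      ¬ HasDoubleDescent ((B ++ [m]).filter (· ≤ k)) ∧
      (A.filter (· ≤ k) ≠ [] → B.filter (· ≤ k) ≠ []) := by
    intro k
    by_cases hk : a ≤ k
    · have hmk : m ≤ k := by omega
      simp only [List.filter_append, List.filter_cons, hk, hmk, decide_true, if_true,
        List.filter_nil]
      have hA' := filter_le_lt (k := k) hA
      have hB' := filter_le_lt (k := k) hB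
      generalize A.filter (· ≤ k) = A at *
      generalize B.filter (· ≤ k) = B at *
      rcases B with _ | ⟨b, B⟩
      · rw [List.nil_append, hasDoubleDescent_append_pair hA' hm]
        have := not_hasDoubleDescent_singleton
        rcases eq_or_ne A [] with rfl | h
        · simp [this]
        · simp [h]
      · rw [List.cons_append, hasDoubleDescent_append_cons_cons (hB' b (by simp))]
        simp
    · have hk' := not_le.1 hk
      simp only [List.filter_append, List.filter_cons, hk, decide_false, List.filter_nil,
        filter_le_eq_nil hA hk', filter_le_eq_nil hB hk']
      have := not_hasDoubleDescent_singleton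
      simp [not_hasDoubleDescent_nil]
  simp only [SimsunWord, key, forall_and]
  refine and_congr_right fun _ => and_congr_right fun _ => ?_
  simp only [ne_eq, List.filter_eq_nil_iff, decide_eq_true_eq, not_le, not_forall, not_lt]
  constructor
  · intro h x hx
    obtain ⟨y, hy, hyx⟩ := h x ⟨x, hx, le_rfl⟩
    exact ⟨y, hy, hyx⟩
  · rintro h k ⟨x, hx, hxk⟩
    obtain ⟨y, hy, hyx⟩ := h x hx
    exact ⟨y, hy, hyx.trans hxk⟩

theorem simsunWord_singleton (v : ℕ) : SimsunWord [v] := by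
  intro k
  by_cases h : v ≤ k <;> simp [h, not_hasDoubleDescent_nil, not_hasDoubleDescent_singleton]

theorem simsunWord_pair (a m : ℕ) : SimsunWord [a, m] := by
  intro k
  by_cases h : a ≤ k <;> by_cases h' : m ≤ k <;>
    simp [h, h', not_hasDoubleDescent_nil, hasDoubleDescent_cons]

/-! ### The words of increasing trees are simsun -/

/-- The final letter `m` is needed because in `φ` the inorder word of a left subtree is followed by
its smaller right sibling. -/
theorem simsunWord_inorder {T : Tree12} (h : T.IsIncreasing) {m : ℕ} (hm : m < T.root) :
    SimsunWord (T.inorder ++ [m]) := by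
  induction T generalizing m with
  | leaf a => exact simsunWord_pair a m
  | one a c ih =>
    simp only [IsIncreasing, root, inorder] at *
    have := (simsunWord_append_cons_append (A := []) (B := c.inorder) (a := a) (m := m) (by simp)
      (fun y hy => h.1.trans_le (root_le_of_mem h.2 (mem_inorder.1 hy))) hm).2
      ⟨simsunWord_singleton a, ih h.2 (by omega), by simp⟩
    simpa using this
  | two a l r ihl ihr =>
    simp only [IsIncreasing, root, inorder] at *
    obtain ⟨h1, h2, hl, hr⟩ := h
    have := (simsunWord_append_cons_append (A := l.inorder) (B := r.inorder) (a := a) (m := m)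
      (fun y hy => (h1.trans h2).trans_le (root_le_of_mem hl (mem_inorder.1 hy)))
      (fun y hy => h1.trans_le (root_le_of_mem hr (mem_inorder.1 hy))) hm).2
      ⟨ihl hl (by omega), ihr hr (by omega), fun x hx => ⟨r.root, root_mem_inorder r,
        h2.le.trans (root_le_of_mem hl (mem_inorder.1 hx))⟩⟩
    simpa using this

theorem simsunWord_phi {T : Tree12} (h : T.IsIncreasing) (hT : T.preorder.Nodup) :
    SimsunWord (phi T) := by
  have key : ∀ r : Tree12, r.IsIncreasing → r.preorder.Nodup → ∀ y ∈ phi r, r.root < y := by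
    intro r hr hn y hy
    have hp := root_cons_phi_perm_preorder r
    have h1 := root_le_of_mem hr (hp.mem_iff.1 (List.mem_cons_of_mem _ hy))
    have h2 := (List.nodup_cons.1 (hp.nodup_iff.2 hn)).1
    exact lt_of_le_of_ne h1 fun e => h2 (e ▸ hy)
  induction T with
  | leaf a => exact simsunWord_nil
  | one a c ih =>
    simp only [IsIncreasing, preorder, List.nodup_cons] at *
    exact (simsunWord_append_cons (A := []) (by simp) (key c h.2 hT.2)).2
      ⟨simsunWord_singleton _, ih h.2 hT.2⟩
  | two a l r ihl ihr =>
    simp only [IsIncreasing, preorder, List.nodup_cons, List.nodup_append] at *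
    obtain ⟨h1, h2, hl, hr⟩ := h
    exact (simsunWord_append_cons
      (fun y hy => h2.trans_le (root_le_of_mem hl (mem_inorder.1 hy))) (key r hr hT.2.1)).2
      ⟨simsunWord_inorder hl h2, ihr hr hT.2.1⟩

/-! ### Every simsun word comes from a tree -/

theorem exists_split_min {w : List ℕ} (hw : w ≠ []) (hn : w.Nodup) :
    ∃ A v B, w = A ++ v :: B ∧ (∀ y ∈ A, v < y) ∧ ∀ y ∈ B, v < y := by
  have hm : w.min hw ∈ w := List.min_mem hw
  obtain ⟨A, B, h⟩ := List.append_of_mem hm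
  have hle : ∀ y ∈ w, w.min hw ≤ y := fun y hy => List.min_le_of_mem hy
  generalize w.min hw = v at *
  subst h
  have hn' := List.nodup_middle.1 hn
  simp only [List.nodup_cons, List.mem_append, not_or] at hn'
  refine ⟨A, v, B, rfl, fun y hy => ?_, fun y hy => ?_⟩
  · exact lt_of_le_of_ne (hle y (by simp [hy])) fun e => hn'.1.1 (e ▸ hy)
  · exact lt_of_le_of_ne (hle y (by simp [hy])) fun e => hn'.1.2 (e ▸ hy)

theorem exists_inorder_eq {w : List ℕ} (hw : w ≠ []) (hn : w.Nodup) {m : ℕ} (hm : ∀ y ∈ w, m < y)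
    (hs : SimsunWord (w ++ [m])) : ∃ T : Tree12, T.IsIncreasing ∧ T.inorder = w := by
  induction hk : w.length using Nat.strong_induction_on generalizing w m with
  | _ k ih =>
    obtain ⟨A, a, B, rfl, hA, hB⟩ := exists_split_min hw hn
    rw [List.append_assoc, List.cons_append, simsunWord_append_cons_append hA hB
      (hm a (by simp))] at hs
    obtain ⟨hsA, hsB, hAB⟩ := hs
    obtain ⟨hnA, hnaB, hdis⟩ := List.nodup_append.1 hn
    have hnB := (List.nodup_cons.1 hnaB).2
    simp only [List.length_append, List.length_cons] at hk
    have hR : B ≠ [] → ∃ T : Tree12, T.IsIncreasing ∧ T.inorder = B := fun h =>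
      ih _ (by omega) h hnB (fun y hy => hm y (by simp [hy])) hsB rfl
    have hL : A ≠ [] → ∃ T : Tree12, T.IsIncreasing ∧ T.inorder = A := fun h =>
      ih _ (by omega) h hnA hA hsA rfl
    rcases eq_or_ne A [] with rfl | hA0
    · rcases eq_or_ne B [] with rfl | hB0
      · exact ⟨leaf a, trivial, rfl⟩
      · obtain ⟨c, hc, rfl⟩ := hR hB0
        exact ⟨one a c, ⟨hB _ (root_mem_inorder c), hc⟩, rfl⟩
    · obtain ⟨l, hl, rfl⟩ := hL hA0
      -- A nonempty left part thus forces a nonempty right part whose minimum is at most `l.root`;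
      -- distinctness of the letters makes this strict.
      obtain ⟨y, hy, hyl⟩ := hAB _ (root_mem_inorder l)
      obtain ⟨r, hr, rfl⟩ := hR (List.ne_nil_of_mem hy)
      refine ⟨two a l r, ⟨hB _ (root_mem_inorder r), ?_, hl, hr⟩, rfl⟩
      refine lt_of_le_of_ne ((root_le_of_mem hr (mem_inorder.1 hy)).trans hyl) fun e => ?_
      exact hdis _ (root_mem_inorder l) _ (List.mem_cons_of_mem _ (root_mem_inorder r)) e.symm

/-- The root label is prescribed because `phi` does not record it. -/
theorem exists_phi_eq {w : List ℕ} (hn : w.Nodup) {a : ℕ} (ha : ∀ y ∈ w, a < y)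
    (hs : SimsunWord w) : ∃ T : Tree12, T.IsIncreasing ∧ T.root = a ∧ phi T = w := by
  induction hk : w.length using Nat.strong_induction_on generalizing w a with
  | _ k ih =>
    rcases eq_or_ne w [] with rfl | hw
    · exact ⟨leaf a, trivial, rfl, rfl⟩
    obtain ⟨A, v, B, rfl, hA, hB⟩ := exists_split_min hw hn
    rw [simsunWord_append_cons hA hB] at hs
    obtain ⟨hnA, hnaB, hdis⟩ := List.nodup_append.1 hn
    simp only [List.length_append, List.length_cons] at hk
    obtain ⟨r, hr, rfl, rfl⟩ := ih _ (by omega) (List.nodup_cons.1 hnaB).2 hB hs.2 rfl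
    rcases eq_or_ne A [] with rfl | hA0
    · exact ⟨one a r, ⟨ha _ (by simp), hr⟩, rfl, rfl⟩
    · obtain ⟨l, hl, rfl⟩ := exists_inorder_eq hA0 hnA hA hs.1
      exact ⟨two a l r, ⟨ha _ (by simp), hA _ (root_mem_inorder l), hl, hr⟩, rfl, rfl⟩

/-! ### The words determine the trees -/

/-- The minimum of a word, occurring only once, fixes the place of the cut. This drives the
injectivity of both inorder and `phi`. -/
theorem append_cons_inj_of_lt {A B A' B' : List ℕ} {v v' : ℕ} (hA : ∀ y ∈ A, v < y)
    (hB : ∀ y ∈ B, v < y) (hA' : ∀ y ∈ A', v' < y) (hB' : ∀ y ∈ B', v' < y)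
    (h : A ++ v :: B = A' ++ v' :: B') : A = A' ∧ v = v' ∧ B = B' := by
  have e : v = v' := by
    have h1 : v ∈ A' ++ v' :: B' := h ▸ by simp
    have h2 : v' ∈ A ++ v :: B := h ▸ by simp
    simp only [List.mem_append, List.mem_cons] at h1 h2
    have h3 : v' ≤ v := by
      rcases h1 with h1 | h1 | h1
      · exact (hA' _ h1).le
      · exact h1.ge
      · exact (hB' _ h1).le
    have h4 : v ≤ v' := by
      rcases h2 with h1 | h1 | h1
      · exact (hA _ h1).le
      · exact h1.ge
      · exact (hB _ h1).le
    exact le_antisymm h4 h3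
  subst e
  induction A generalizing A' with
  | nil =>
    cases A' with
    | nil => simpa using h
    | cons x A' =>
      simp only [List.nil_append, List.cons_append, List.cons.injEq] at h
      have := hA' x (by simp)
      omega
  | cons x A ih =>
    cases A' with
    | nil =>
      simp only [List.nil_append, List.cons_append, List.cons.injEq] at h
      have := hA x (by simp)
      omega
    | cons x' A' =>
      simp only [List.cons_append, List.cons.injEq] at h
      obtain ⟨rfl, h⟩ := h
      obtain ⟨rfl, -, rfl⟩ := ih (fun y hy => hA y (by simp [hy]))
        (fun y hy => hA' y (by simp [hy])) h
      exact ⟨rfl, rfl, rfl⟩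

/-- The words of the left and of the right subtree around the root in inorder. -/
def inorderParts : Tree12 → List ℕ × List ℕ
  | leaf _ => ([], [])
  | one _ c => ([], c.inorder)
  | two _ l r => (l.inorder, r.inorder)

theorem inorder_eq_parts (T : Tree12) :
    T.inorder = (inorderParts T).1 ++ T.root :: (inorderParts T).2 := by
  cases T <;> rfl

theorem root_lt_of_mem_parts {T : Tree12} (h : T.IsIncreasing) :
    (∀ y ∈ (inorderParts T).1, T.root < y) ∧ ∀ y ∈ (inorderParts T).2, T.root < y := by
  cases T with
  | leaf a => simp [inorderParts]
  | one a c =>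
    exact ⟨by simp [inorderParts],
      fun y hy => h.1.trans_le (root_le_of_mem h.2 (mem_inorder.1 hy))⟩
  | two a l r =>
    obtain ⟨h1, h2, hl, hr⟩ := h
    exact ⟨fun y hy => (h1.trans h2).trans_le (root_le_of_mem hl (mem_inorder.1 hy)),
      fun y hy => h1.trans_le (root_le_of_mem hr (mem_inorder.1 hy))⟩

theorem inorder_injOn : Set.InjOn inorder {T | T.IsIncreasing} := by
  intro T hT T' hT' h
  induction T generalizing T' with
  | leaf a =>
    rw [inorder_eq_parts, inorder_eq_parts T'] at h
    obtain ⟨h1, h2, h3⟩ := append_cons_inj_of_lt (root_lt_of_mem_parts hT).1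
      (root_lt_of_mem_parts hT).2 (root_lt_of_mem_parts hT').1 (root_lt_of_mem_parts hT').2 h
    cases T' with
    | leaf a' => exact congrArg leaf h2
    | one a' c' => exact absurd h3.symm (inorder_ne_nil _)
    | two a' l' r' => exact absurd h3.symm (inorder_ne_nil _)
  | one a c ih =>
    rw [inorder_eq_parts, inorder_eq_parts T'] at h
    obtain ⟨h1, h2, h3⟩ := append_cons_inj_of_lt (root_lt_of_mem_parts hT).1
      (root_lt_of_mem_parts hT).2 (root_lt_of_mem_parts hT').1 (root_lt_of_mem_parts hT').2 h
    cases T' with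
    | leaf a' => exact absurd h3 (inorder_ne_nil _)
    | one a' c' =>
      obtain rfl : a = a' := h2
      rw [ih hT.2 hT'.2 h3]
    | two a' l' r' => exact absurd h1.symm (inorder_ne_nil _)
  | two a l r ihl ihr =>
    rw [inorder_eq_parts, inorder_eq_parts T'] at h
    obtain ⟨h1, h2, h3⟩ := append_cons_inj_of_lt (root_lt_of_mem_parts hT).1
      (root_lt_of_mem_parts hT).2 (root_lt_of_mem_parts hT').1 (root_lt_of_mem_parts hT').2 h
    cases T' with
    | leaf a' => exact absurd h3 (inorder_ne_nil _)
    | one a' c' => exact absurd h1 (inorder_ne_nil _)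
    | two a' l' r' =>
      obtain rfl : a = a' := h2
      rw [ihl hT.2.2.1 hT'.2.2.1 h1, ihr hT.2.2.2 hT'.2.2.2 h3]

theorem root_lt_of_mem_phi {T : Tree12} (h : T.IsIncreasing) {y : ℕ} (hy : y ∈ phi T) :
    T.root < y := by
  induction T with
  | leaf a => simp [phi] at hy
  | one a c ih =>
    simp only [phi, List.mem_cons, root] at *
    rcases hy with rfl | hy
    · exact h.1
    · exact h.1.trans (ih h.2 hy)
  | two a l r ihl ihr =>
    simp only [phi, List.mem_cons, List.mem_append, root] at *
    obtain ⟨h1, h2, hl, hr⟩ := h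
    rcases hy with hy | rfl | hy
    · exact (h1.trans h2).trans_le (root_le_of_mem hl (mem_inorder.1 hy))
    · exact h1
    · exact h1.trans (ihr hr hy)

theorem eq_of_phi_eq {T T' : Tree12} (hT : T.IsIncreasing) (hT' : T'.IsIncreasing)
    (hr : T.root = T'.root) (h : phi T = phi T') : T = T' := by
  have key : ∀ {A : List ℕ} {r : Tree12} {A' : List ℕ} {r' : Tree12}, r.IsIncreasing →
      r'.IsIncreasing → (∀ y ∈ A, r.root < y) → (∀ y ∈ A', r'.root < y) →
      A ++ r.root :: phi r = A' ++ r'.root :: phi r' →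
      A = A' ∧ r.root = r'.root ∧ phi r = phi r' :=
    fun hr hr' hA hA' h => append_cons_inj_of_lt hA (fun _ => root_lt_of_mem_phi hr) hA'
      (fun _ => root_lt_of_mem_phi hr') h
  have hlow : ∀ {a : ℕ} {l r : Tree12}, (two a l r).IsIncreasing → ∀ y ∈ l.inorder, r.root < y :=
    fun h y hy => h.2.1.trans_le (root_le_of_mem h.2.2.1 (mem_inorder.1 hy))
  induction T generalizing T' with
  | leaf a =>
    cases T' with
    | leaf a' => exact congrArg leaf hr
    | one a' c' => simp [phi] at h
    | two a' l' r' => simp [phi] at h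
  | one a c ih =>
    cases T' with
    | leaf a' => simp [phi] at h
    | one a' c' =>
      obtain rfl : a = a' := hr
      obtain ⟨-, h2, h3⟩ := key (A := []) (A' := []) hT.2 hT'.2 (by simp) (by simp) h
      rw [ih hT.2 hT'.2 h2 h3]
    | two a' l' r' =>
      obtain ⟨h1, -, -⟩ := key (A := []) hT.2 hT'.2.2.2 (by simp) (hlow hT') h
      exact absurd h1.symm (inorder_ne_nil _)
  | two a l r ihl ihr =>
    cases T' with
    | leaf a' => simp [phi] at h
    | one a' c' =>
      obtain ⟨h1, -, -⟩ := key (A' := []) hT.2.2.2 hT'.2 (hlow hT) (by simp) h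
      exact absurd h1 (inorder_ne_nil _)
    | two a' l' r' =>
      obtain rfl : a = a' := hr
      obtain ⟨h1, h2, h3⟩ := key hT.2.2.2 hT'.2.2.2 (hlow hT) (hlow hT') h
      rw [inorder_injOn hT.2.2.1 hT'.2.2.1 h1, ihr hT.2.2.2 hT'.2.2.2 h2 h3]

/-! ### The map `φ` is a bijection -/

theorem root_eq_zero {n : ℕ} {T : Tree12} (h : T ∈ IncTrees n) : T.root = 0 :=
  Nat.le_zero.1 (root_le_of_mem h.1 (h.2.mem_iff.2 (by simp)))

theorem range_succ_eq_cons (n : ℕ) : List.range (n + 1) = 0 :: List.range' 1 n := by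
  rw [List.range_eq_range', List.range'_succ]

theorem perm_range_iff {n : ℕ} {T : Tree12} (h : T.root = 0) :
    T.preorder.Perm (List.range (n + 1)) ↔ (phi T).Perm (List.range' 1 n) := by
  rw [← (root_cons_phi_perm_preorder T).congr_left, h, range_succ_eq_cons, List.perm_cons]

theorem oneLine_perm {n : ℕ} (σ : Equiv.Perm (Fin n)) :
    (oneLine σ).Perm (List.range' 1 n) := by
  refine (List.perm_ext_iff_of_nodup ?_ (List.nodup_range')).2 fun x => ?_
  · refine List.nodup_ofFn.2 fun i j h => σ.injective (Fin.ext ?_)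
    simpa using h
  · simp only [oneLine, List.mem_ofFn, List.mem_range'_1]
    constructor
    · rintro ⟨i, rfl⟩
      have := (σ i).isLt
      omega
    · rintro ⟨h1, h2⟩
      refine ⟨σ.symm ⟨x - 1, by omega⟩, ?_⟩
      simp only [Equiv.apply_symm_apply]
      omega

theorem exists_oneLine_eq {n : ℕ} {w : List ℕ} (h : w.Perm (List.range' 1 n)) :
    ∃ σ : Equiv.Perm (Fin n), oneLine σ = w := by
  have hlen : w.length = n := by simpa using h.length_eq
  subst hlen
  have hmem : ∀ i : Fin w.length, 1 ≤ w.get i ∧ w.get i < 1 + w.length := fun i =>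
    List.mem_range'_1.1 (h.mem_iff.1 (List.get_mem w i))
  let f : Fin w.length → Fin w.length := fun i => ⟨w.get i - 1, by have := hmem i; omega⟩
  have hf : Function.Injective f := by
    intro i j hij
    have h1 : w.get i - 1 = w.get j - 1 := congrArg Fin.val hij
    have h2 := hmem i
    have h3 := hmem j
    exact (List.nodup_iff_injective_get.1 (h.nodup_iff.2 List.nodup_range')) (by omega)
  refine ⟨Equiv.ofBijective f (Finite.injective_iff_bijective.1 hf), ?_⟩
  conv_rhs => rw [← List.ofFn_get w]
  refine congrArg List.ofFn (funext fun i => ?_)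
  have := hmem i
  change w.get i - 1 + 1 = w.get i
  omega

theorem oneLine_injective {n : ℕ} : Function.Injective (oneLine (n := n)) := by
  intro σ τ h
  refine Equiv.ext fun i => Fin.ext ?_
  have := congrFun (List.ofFn_injective h) i
  simpa using this

theorem phi_bijOn (n : ℕ) : BijOn phi (IncTrees n) (oneLine '' RS n) := by
  refine ⟨fun T hT => ?_, fun T hT T' hT' h => ?_, ?_⟩
  · obtain ⟨σ, hσ⟩ := exists_oneLine_eq ((perm_range_iff (root_eq_zero hT)).1 hT.2)
    refine ⟨σ, ?_, hσ⟩
    have := simsunWord_phi hT.1 (hT.2.nodup_iff.2 List.nodup_range)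
    rw [← hσ] at this
    exact this
  · exact eq_of_phi_eq hT.1 hT'.1 ((root_eq_zero hT).trans (root_eq_zero hT').symm) h
  · rintro _ ⟨σ, hσ, rfl⟩
    have hp := oneLine_perm σ
    obtain ⟨T, hT, h0, h⟩ := exists_phi_eq (a := 0) (hp.nodup_iff.2 List.nodup_range')
      (fun y hy => by have := List.mem_range'_1.1 (hp.mem_iff.1 hy); omega) hσ
    exact ⟨T, ⟨hT, (perm_range_iff h0).2 (h ▸ hp)⟩, h⟩

/-! ### Patterns of length three -/

/-- The word `w` avoids the pattern `231`. -/
def Avoids231 (w : List ℕ) : Prop := w.Triplewise fun x y z => ¬ (z < x ∧ x < y)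

/-- The word `w` avoids the pattern `213`. -/
def Avoids213 (w : List ℕ) : Prop := w.Triplewise fun x y z => ¬ (y < x ∧ x < z)

theorem triplewise_oneLine {n : ℕ} (σ : Equiv.Perm (Fin n)) (p : ℕ → ℕ → ℕ → Prop) :
    (oneLine σ).Triplewise p ↔
      ∀ i j k : Fin n, i < j → j < k → p (σ i + 1) (σ j + 1) (σ k + 1) := by
  rw [List.triplewise_iff_getElem]
  constructor
  · intro h i j k hij hjk
    simpa [oneLine] using h i j k hij hjk (by simp [oneLine])
  · intro h i j k hij hjk hk
    have hk' : k < n := by simpa [oneLine] using hk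
    simpa [oneLine] using h ⟨i, by omega⟩ ⟨j, by omega⟩ ⟨k, hk'⟩ hij hjk

theorem strictMono_vec3 {n : ℕ} {i j k : Fin n} (hij : i < j) (hjk : j < k) :
    StrictMono ![i, j, k] := by
  rw [Fin.strictMono_iff_lt_succ]
  intro a
  fin_cases a
  · exact hij
  · exact hjk

theorem avoids231_oneLine {n : ℕ} (σ : Equiv.Perm (Fin n)) :
    Avoids231 (oneLine σ) ↔ ¬ ContainsPattern σ ![2, 3, 1] := by
  rw [Avoids231, triplewise_oneLine]
  constructor
  · rintro h ⟨i, hi, hσ⟩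
    refine h (i 0) (i 1) (i 2) (hi (by decide)) (hi (by decide)) ⟨?_, ?_⟩
    · have := (hσ 2 0).2 (by decide)
      rw [Fin.lt_def] at this
      omega
    · have := (hσ 0 1).2 (by decide)
      rw [Fin.lt_def] at this
      omega
  · rintro h i j k hij hjk ⟨h1, h2⟩
    refine h ⟨![i, j, k], strictMono_vec3 hij hjk, fun a b => ?_⟩
    rw [Fin.lt_def]
    fin_cases a <;> fin_cases b <;> simp <;> omega

theorem avoids213_oneLine {n : ℕ} (σ : Equiv.Perm (Fin n)) :
    Avoids213 (oneLine σ) ↔ ¬ ContainsPattern σ ![2, 1, 3] := by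
  rw [Avoids213, triplewise_oneLine]
  constructor
  · rintro h ⟨i, hi, hσ⟩
    refine h (i 0) (i 1) (i 2) (hi (by decide)) (hi (by decide)) ⟨?_, ?_⟩
    · have := (hσ 1 0).2 (by decide)
      rw [Fin.lt_def] at this
      omega
    · have := (hσ 0 2).2 (by decide)
      rw [Fin.lt_def] at this
      omega
  · rintro h i j k hij hjk ⟨h1, h2⟩
    refine h ⟨![i, j, k], strictMono_vec3 hij hjk, fun a b => ?_⟩
    rw [Fin.lt_def]
    fin_cases a <;> fin_cases b <;> simp <;> omega

/-! ### Avoiding `213` means increasing in right-to-left preorder -/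

/-- The minimum `v` plays the letter 1 of the pattern between any `x ∈ A` and a larger `y ∈ B`. If
there is no such pair, no occurrence can meet more than one of the parts. -/
theorem avoids213_append_cons {A B : List ℕ} {v : ℕ} (hA : ∀ y ∈ A, v < y)
    (hB : ∀ y ∈ B, v < y) :
    Avoids213 (A ++ v :: B) ↔ Avoids213 A ∧ Avoids213 B ∧ ∀ x ∈ A, ∀ y ∈ B, y ≤ x := by
  simp only [Avoids213, List.triplewise_append, List.triplewise_cons, List.pairwise_cons,
    List.mem_cons, forall_eq_or_imp]
  constructor
  · rintro ⟨h1, ⟨-, h2⟩, h3, -, -⟩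
    refine ⟨h1, h2, fun x hx y hy => ?_⟩
    by_contra hlt
    exact (h3 x hx).1 y hy ⟨hA x hx, by omega⟩
  · rintro ⟨h1, h2, h3⟩
    refine ⟨h1, ⟨?_, h2⟩, fun x hx => ⟨fun y hy => ?_, ?_⟩, ?_, fun y hy => ?_⟩
    -- Starting from the trivial relation leaves only the memberships of the two letters as
    -- hypotheses; their order is irrelevant.
    · refine List.Pairwise.imp_of_mem ?_ (List.pairwise_of_forall (R := fun _ _ => True) (by simp))
      rintro y z hy - -
      have := hB y hy
      omega
    · have := h3 x hx y hy
      omega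
    · refine List.Pairwise.imp_of_mem ?_ (List.pairwise_of_forall (R := fun _ _ => True) (by simp))
      rintro y z hy hz -
      have := h3 x hx z hz
      omega
    · refine List.Pairwise.imp_of_mem ?_ (List.pairwise_of_forall (R := fun _ _ => True) (by simp))
      rintro y z hy hz -
      have := hA y hy
      omega
    · refine List.Pairwise.imp_of_mem ?_ (List.pairwise_of_forall (R := fun _ _ => True) (by simp))
      rintro z t hz ht -
      have := h3 z hz y hy
      omega

theorem sorted_preorder_two {a : ℕ} {l r : Tree12} (h : (two a l r).IsIncreasing)
    (hn : (two a l r).preorder.Nodup) :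
    (two a l r).preorder.Pairwise (· < ·) ↔ l.preorder.Pairwise (· < ·) ∧
      r.preorder.Pairwise (· < ·) ∧ ∀ x ∈ l.preorder, ∀ y ∈ r.preorder, y ≤ x := by
  simp only [preorder, List.nodup_cons, List.nodup_append, List.pairwise_cons,
    List.pairwise_append, List.mem_append] at *
  obtain ⟨h1, h2, hl, hr⟩ := h
  constructor
  · rintro ⟨-, h3, h4, h5⟩
    exact ⟨h4, h3, fun x hx y hy => (h5 y hy x hx).le⟩
  · rintro ⟨h3, h4, h5⟩
    refine ⟨?_, h4, h3, fun y hy x hx => lt_of_le_of_ne (h5 x hx y hy) (hn.2.2.2 y hy x hx)⟩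
    rintro x (hx | hx)
    · exact h1.trans_le (root_le_of_mem hr hx)
    · exact (h1.trans h2).trans_le (root_le_of_mem hl hx)

theorem avoids213_inorder {T : Tree12} (h : T.IsIncreasing) (hn : T.preorder.Nodup) :
    Avoids213 T.inorder ↔ T.preorder.Pairwise (· < ·) := by
  induction T with
  | leaf a => simp [Avoids213, inorder, preorder]
  | one a c ih =>
    have hc : ∀ y ∈ c.preorder, a < y := fun y hy => h.1.trans_le (root_le_of_mem h.2 hy)
    have := avoids213_append_cons (A := []) (B := c.inorder) (v := a) (by simp)
      fun y hy => hc y (mem_inorder.1 hy)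
    simp only [List.nil_append, ih h.2 (List.nodup_cons.1 hn).2] at this
    rw [inorder, this, preorder, List.pairwise_cons]
    simp only [Avoids213, List.Triplewise.nil, List.not_mem_nil, false_imp_iff, implies_true,
      true_and, and_true]
    exact ⟨fun h => ⟨hc, h⟩, fun h => h.2⟩
  | two a l r ihl ihr =>
    rw [sorted_preorder_two h hn, inorder]
    simp only [preorder, List.nodup_cons, List.nodup_append] at hn
    obtain ⟨h1, h2, hl, hr⟩ := h
    rw [avoids213_append_cons
      (fun y hy => (h1.trans h2).trans_le (root_le_of_mem hl (mem_inorder.1 hy)))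
      (fun y hy => h1.trans_le (root_le_of_mem hr (mem_inorder.1 hy))),
      ihl hl hn.2.2.1, ihr hr hn.2.1]
    simp only [mem_inorder]

theorem avoids213_phi {T : Tree12} (h : T.IsIncreasing) (hn : T.preorder.Nodup) :
    Avoids213 (phi T) ↔ T.preorder.Pairwise (· < ·) := by
  induction T with
  | leaf a => simp [Avoids213, phi, preorder]
  | one a c ih =>
    have hc : ∀ y ∈ c.preorder, a < y := fun y hy => h.1.trans_le (root_le_of_mem h.2 hy)
    have := avoids213_append_cons (A := []) (B := phi c) (v := c.root) (by simp)
      fun y hy => root_lt_of_mem_phi h.2 hy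
    simp only [List.nil_append, ih h.2 (List.nodup_cons.1 hn).2] at this
    rw [phi, this, preorder, List.pairwise_cons]
    simp only [Avoids213, List.Triplewise.nil, List.not_mem_nil, false_imp_iff, implies_true,
      true_and, and_true]
    exact ⟨fun h => ⟨hc, h⟩, fun h => h.2⟩
  | two a l r ihl ihr =>
    rw [sorted_preorder_two h hn, phi]
    simp only [preorder, List.nodup_cons, List.nodup_append] at hn
    obtain ⟨h1, h2, hl, hr⟩ := h
    have hlt : ∀ x ∈ l.preorder, r.root < x := fun x hx => h2.trans_le (root_le_of_mem hl hx)
    rw [avoids213_append_cons (fun y hy => hlt y (mem_inorder.1 hy))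
      (fun y hy => root_lt_of_mem_phi hr hy), avoids213_inorder hl hn.2.2.1, ihr hr hn.2.1]
    simp only [mem_inorder, ← (root_cons_phi_perm_preorder r).mem_iff, List.mem_cons,
      forall_eq_or_imp]
    exact and_congr_right fun _ => and_congr_right fun _ =>
      ⟨fun h x hx => ⟨(hlt x hx).le, h x hx⟩, fun h x hx => (h x hx).2⟩

theorem isIncreasing_of_sorted {T : Tree12} (h : T.preorder.Pairwise (· < ·)) :
    T.IsIncreasing := by
  induction T with
  | leaf a => trivial
  | one a c ih =>
    simp only [preorder, List.pairwise_cons] at h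
    exact ⟨h.1 _ (root_mem_preorder c), ih h.2⟩
  | two a l r ihl ihr =>
    simp only [preorder, List.pairwise_cons, List.pairwise_append, List.mem_append] at h
    exact ⟨h.1 _ (Or.inl (root_mem_preorder r)),
      h.2.2.2 _ (root_mem_preorder r) _ (root_mem_preorder l), ihl h.2.2.1, ihr h.2.1⟩

theorem eq_range_of_sorted {w : List ℕ} {n : ℕ} (h : w.Pairwise (· < ·))
    (hp : w.Perm (List.range n)) : w = List.range n :=
  hp.eq_of_pairwise (fun _ _ _ _ h1 h2 => absurd h2 h1.asymm) h List.pairwise_lt_range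

/-- This puts the ordered trees among the increasing ones, so that injectivity and surjectivity of
`phi` can be inherited. -/
theorem mem_ordTrees_iff {n : ℕ} {T : Tree12} :
    T ∈ OrdTrees n ↔ T ∈ IncTrees n ∧ T.preorder.Pairwise (· < ·) := by
  constructor
  · intro h
    have h' : T.preorder = List.range (n + 1) := h
    have hs : T.preorder.Pairwise (· < ·) := h' ▸ List.pairwise_lt_range
    exact ⟨⟨isIncreasing_of_sorted hs, h' ▸ List.Perm.refl _⟩, hs⟩
  · rintro ⟨h, hs⟩
    exact eq_range_of_sorted hs h.2

theorem phi_bijOn_ordTrees (n : ℕ) :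
    BijOn phi (OrdTrees n) (oneLine '' RSAvoid n ![2, 1, 3]) := by
  have hb := phi_bijOn n
  have key : ∀ T ∈ IncTrees n, Avoids213 (phi T) ↔ T ∈ OrdTrees n := fun T hT => by
    rw [avoids213_phi hT.1 (hT.2.nodup_iff.2 List.nodup_range), mem_ordTrees_iff]
    exact ⟨fun h => ⟨hT, h⟩, fun h => h.2⟩
  refine ⟨fun T hT => ?_, hb.injOn.mono fun T hT => (mem_ordTrees_iff.1 hT).1, ?_⟩
  · have hT' := (mem_ordTrees_iff.1 hT).1
    obtain ⟨σ, hσ, h⟩ := hb.mapsTo hT'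
    exact ⟨σ, ⟨hσ, (avoids213_oneLine σ).1 (h ▸ (key T hT').2 hT)⟩, h⟩
  · rintro _ ⟨σ, hσ, rfl⟩
    obtain ⟨T, hT, h⟩ := hb.surjOn ⟨σ, hσ.1, rfl⟩
    exact ⟨T, (key T hT).1 (h ▸ (avoids213_oneLine σ).2 hσ.2), h⟩

theorem phi_bijOn_trees231 (n : ℕ) :
    BijOn phi (Trees231 n) (oneLine '' RSAvoid n ![2, 3, 1]) := by
  refine ⟨?_, (phi_bijOn n).injOn.mono fun T hT => hT.1, ?_⟩
  · rintro T ⟨-, σ, hσ, h⟩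
    exact ⟨σ, hσ, h.symm⟩
  · rintro _ ⟨σ, hσ, rfl⟩
    obtain ⟨T, hT, h⟩ := (phi_bijOn n).surjOn ⟨σ, hσ.1, rfl⟩
    exact ⟨T, ⟨hT, σ, hσ, h⟩, h⟩

theorem mem_trees231_iff {n : ℕ} {T : Tree12} :
    T ∈ Trees231 n ↔ T ∈ IncTrees n ∧ Avoids231 (phi T) := by
  constructor
  · rintro ⟨hT, σ, hσ, h⟩
    exact ⟨hT, h ▸ (avoids231_oneLine σ).2 hσ.2⟩
  · rintro ⟨hT, ha⟩
    obtain ⟨σ, hσ, h⟩ := (phi_bijOn n).mapsTo hT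
    exact ⟨hT, σ, ⟨hσ, (avoids231_oneLine σ).1 (h ▸ ha)⟩, h.symm⟩

/-! ### Caterpillars -/

/-- The caterpillar with root `a` whose spine has the labels `x` for `(x, o)` in the list; the
vertex `x` has a sibling `u`, which is a leaf, if `o = some u`. -/
def cat : ℕ → List (ℕ × Option ℕ) → Tree12
  | a, [] => leaf a
  | a, (x, none) :: L => one a (cat x L)
  | a, (x, some u) :: L => two a (leaf u) (cat x L)

/-- The word `φ` of a caterpillar. -/
def catWord : List (ℕ × Option ℕ) → List ℕ
  | [] => []
  | (x, none) :: L => x :: catWord L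
  | (x, some u) :: L => u :: x :: catWord L

/-- The only and right children of a tree in right-to-left preorder, together with their left
siblings. -/
def code : Tree12 → List (ℕ × Option ℕ)
  | leaf _ => []
  | one _ c => (c.root, none) :: code c
  | two _ l r => (r.root, some l.root) :: (code r ++ code l)

theorem root_cat (a : ℕ) (L : List (ℕ × Option ℕ)) : (cat a L).root = a := by
  rcases L with _ | ⟨⟨x, _ | u⟩, L⟩ <;> rfl

theorem phi_cat (a : ℕ) (L : List (ℕ × Option ℕ)) : phi (cat a L) = catWord L := by
  induction L generalizing a with
  | nil => rfl
  | cons p L ih =>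
    obtain ⟨x, _ | u⟩ := p <;> simp [cat, phi, catWord, root_cat, ih, inorder]

theorem catWord_append (L M : List (ℕ × Option ℕ)) :
    catWord (L ++ M) = catWord L ++ catWord M := by
  induction L with
  | nil => rfl
  | cons p L ih => obtain ⟨x, _ | u⟩ := p <;> simp [catWord, ih]

theorem cons_catWord_perm (a : ℕ) (L : List (ℕ × Option ℕ)) :
    (a :: catWord L).Perm (cat a L).preorder := by
  simpa [root_cat, phi_cat] using root_cons_phi_perm_preorder (cat a L)

theorem root_cons_catWord_code_perm (S : Tree12) :
    (S.root :: catWord (code S)).Perm S.preorder := by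
  induction S with
  | leaf a => simp [root, code, catWord, preorder]
  | one a c ih => simpa [root, code, catWord, preorder] using ih
  | two a l r ihl ihr =>
    simp only [root, code, catWord, preorder, catWord_append]
    refine List.Perm.cons _ ?_
    refine (List.Perm.trans ?_ (ihr.append ihl))
    exact (List.perm_middle (l₁ := r.root :: catWord (code r))).symm

theorem isIncreasing_cat_mono {a b : ℕ} {L : List (ℕ × Option ℕ)} (hab : a ≤ b)
    (h : (cat b L).IsIncreasing) : (cat a L).IsIncreasing := by
  rcases L with _ | ⟨⟨x, _ | u⟩, L⟩
  · trivial
  · exact ⟨hab.trans_lt h.1, h.2⟩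
  · exact ⟨hab.trans_lt h.1, h.2⟩

theorem isIncreasing_cat_append {a b : ℕ} {L M : List (ℕ × Option ℕ)}
    (hL : (cat a L).IsIncreasing) (hM : (cat b M).IsIncreasing) (hab : a ≤ b)
    (hb : ∀ y ∈ catWord L, y ≤ b) : (cat a (L ++ M)).IsIncreasing := by
  induction L generalizing a with
  | nil => exact isIncreasing_cat_mono hab hM
  | cons p L ih =>
    obtain ⟨x, _ | u⟩ := p
    · simp only [cat, List.cons_append, IsIncreasing, root_cat] at *
      exact ⟨hL.1, ih hL.2 (hb x (by simp [catWord])) fun y hy => hb y (by simp [catWord, hy])⟩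
    · simp only [cat, List.cons_append, IsIncreasing, root_cat] at *
      exact ⟨hL.1, hL.2.1, trivial, ih hL.2.2.2 (hb x (by simp [catWord]))
        fun y hy => hb y (by simp [catWord, hy])⟩

theorem isIncreasing_cat_of_append_left {a : ℕ} {L M : List (ℕ × Option ℕ)}
    (h : (cat a (L ++ M)).IsIncreasing) : (cat a L).IsIncreasing := by
  induction L generalizing a with
  | nil => trivial
  | cons p L ih =>
    obtain ⟨x, _ | u⟩ := p
    · simp only [cat, List.cons_append, IsIncreasing, root_cat] at *
      exact ⟨h.1, ih h.2⟩
    · simp only [cat, List.cons_append, IsIncreasing, root_cat] at *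
      exact ⟨h.1, h.2.1, trivial, ih h.2.2.2⟩

theorem isIncreasing_cat_of_append_right {a b : ℕ} {L M : List (ℕ × Option ℕ)}
    (h : (cat a (L ++ M)).IsIncreasing) (hb : ∀ y ∈ catWord M, b < y) :
    (cat b M).IsIncreasing := by
  induction L generalizing a with
  | nil =>
    rcases M with _ | ⟨⟨x, _ | u⟩, M⟩
    · trivial
    · exact ⟨by simpa [root_cat] using hb x (by simp [catWord]), h.2⟩
    · exact ⟨by simpa [root_cat] using hb x (by simp [catWord]), h.2⟩
  | cons p L ih =>
    obtain ⟨x, _ | u⟩ := p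
    · exact ih h.2
    · exact ih h.2.2.2

theorem root_cat_lt {a : ℕ} {L : List (ℕ × Option ℕ)} (h : (cat a L).IsIncreasing) :
    ∀ y ∈ catWord L, a < y := fun y hy => by
  simpa [root_cat] using root_lt_of_mem_phi h (phi_cat a L ▸ hy)

/-! ### The caterpillar of an ordered tree -/

theorem isIncreasing_cat_code {S : Tree12} (h : S.preorder.Pairwise (· < ·)) :
    (cat S.root (code S)).IsIncreasing := by
  induction S with
  | leaf a => trivial
  | one a c ih =>
    simp only [preorder, List.pairwise_cons] at h
    refine ⟨?_, ih h.2⟩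
    rw [root_cat]
    exact h.1 _ (root_mem_preorder c)
  | two a l r ihl ihr =>
    simp only [preorder, List.pairwise_cons, List.pairwise_append, List.mem_append] at h
    obtain ⟨h1, h2, h3, h4⟩ := h
    have hr := root_mem_preorder r
    have hl := root_mem_preorder l
    have hrl := h4 _ hr _ hl
    refine ⟨?_, ?_, trivial, isIncreasing_cat_append (ihr h2) (ihl h3) hrl.le fun y hy => ?_⟩
    · rw [root_cat]
      exact h1 _ (Or.inl hr)
    · rw [root_cat]
      exact hrl
    · exact (h4 y ((root_cons_catWord_code_perm r).mem_iff.1 (List.mem_cons_of_mem _ hy)) _ hl).le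

theorem avoids231_append {A B : List ℕ} (hA : Avoids231 A) (hB : Avoids231 B)
    (h : ∀ x ∈ A, ∀ y ∈ B, x < y) : Avoids231 (A ++ B) := by
  refine List.triplewise_append.2 ⟨hA, hB, fun x hx => ?_, fun y hy => ?_⟩
  · refine List.Pairwise.imp_of_mem ?_ (List.pairwise_of_forall (R := fun _ _ => True) (by simp))
    rintro y z hy hz -
    have := h x hx z hz
    omega
  · refine List.Pairwise.imp_of_mem ?_ (List.pairwise_of_forall (R := fun _ _ => True) (by simp))
    rintro x z hx hz -
    have := h x hx y hy
    omega

theorem avoids231_cons_of_lt {A : List ℕ} {v : ℕ} (hA : Avoids231 A) (h : ∀ x ∈ A, v < x) :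
    Avoids231 (v :: A) := by
  refine List.triplewise_cons.2 ⟨?_, hA⟩
  refine List.Pairwise.imp_of_mem ?_ (List.pairwise_of_forall (R := fun _ _ => True) (by simp))
  rintro y z hy hz -
  have := h z hz
  omega

theorem avoids231_cons_of_gt {A : List ℕ} {v : ℕ} (hA : Avoids231 A) (h : ∀ x ∈ A, x < v) :
    Avoids231 (v :: A) := by
  refine List.triplewise_cons.2 ⟨?_, hA⟩
  refine List.Pairwise.imp_of_mem ?_ (List.pairwise_of_forall (R := fun _ _ => True) (by simp))
  rintro y z hy hz -
  have := h y hy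
  omega

/-- For a root with two children the word is `u x R L`, with `u` the left and `x` the right child:
`x` lies below `R`, `u` lies above `x R`, and everything in `u x R` lies below `L`. -/
theorem avoids231_catWord_code {S : Tree12} (h : S.preorder.Pairwise (· < ·)) :
    Avoids231 (catWord (code S)) := by
  have key : ∀ {r : Tree12}, r.preorder.Pairwise (· < ·) → ∀ y ∈ catWord (code r), r.root < y :=
    fun hr => root_cat_lt (isIncreasing_cat_code hr)
  induction S with
  | leaf a => exact List.Triplewise.nil
  | one a c ih =>
    simp only [preorder, List.pairwise_cons] at h
    exact avoids231_cons_of_lt (ih h.2) (key h.2)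
  | two a l r ihl ihr =>
    simp only [preorder, List.pairwise_cons, List.pairwise_append, List.mem_append] at h
    obtain ⟨h1, h2, h3, h4⟩ := h
    have hl := root_mem_preorder l
    have hmem : ∀ y ∈ r.root :: catWord (code r), y < l.root := fun y hy =>
      h4 y ((root_cons_catWord_code_perm r).mem_iff.1 hy) _ hl
    have := avoids231_append
      (avoids231_cons_of_gt (avoids231_cons_of_lt (ihr h2) (key h2)) hmem) (ihl h3) ?_
    · simpa [code, catWord, catWord_append] using this
    · intro x hx y hy
      rcases List.mem_cons.1 hx with rfl | hx
      · exact key h3 y hy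
      · exact (hmem x hx).trans (key h3 y hy)

theorem cat_code_mem_trees231 {n : ℕ} {S : Tree12} (h : S ∈ OrdTrees n) :
    cat 0 (code S) ∈ Trees231 n := by
  obtain ⟨h1, h2⟩ := mem_ordTrees_iff.1 h
  have h0 := root_eq_zero h1
  refine mem_trees231_iff.2 ⟨⟨h0 ▸ isIncreasing_cat_code h2, ?_⟩, ?_⟩
  · refine (cons_catWord_perm 0 (code S)).symm.trans ?_
    rw [← h0]
    exact (root_cons_catWord_code_perm S).trans h1.2
  · rw [phi_cat]
    exact avoids231_catWord_code h2

/-! ### Every tree of a `231`-avoiding simsun permutation is such a caterpillar -/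

/-- The letter `r.root` comes after the inorder word of `l` and lies below it, so that word has no
increasing pair. A left child that is not a leaf would form one with its own right child. -/
theorem exists_eq_cat {T : Tree12} (h : T.IsIncreasing) (ha : Avoids231 (phi T)) :
    ∃ L, T = cat T.root L := by
  induction T with
  | leaf a => exact ⟨[], rfl⟩
  | one a c ih =>
    obtain ⟨L, hL⟩ := ih h.2 (List.triplewise_cons.1 ha).2
    exact ⟨(c.root, none) :: L, by rw [root, cat, ← hL]⟩
  | two a l r ihl ihr =>
    obtain ⟨h1, h2, hl, hr⟩ := h
    obtain ⟨ha1, ha2, -, ha4⟩ := List.triplewise_append.1 ha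
    obtain ⟨L, hL⟩ := ihr hr (List.triplewise_cons.1 ha2).2
    have hlow : ∀ y ∈ l.inorder, r.root < y := fun y hy =>
      h2.trans_le (root_le_of_mem hl (mem_inorder.1 hy))
    have hp := ha4 r.root (by simp)
    have key : ∀ (A B : List ℕ) (b : ℕ), l.inorder = A ++ b :: B → ∀ y ∈ B, ¬ b < y := by
      intro A B b e y hy hlt
      rw [e] at hp hlow
      exact (List.pairwise_cons.1 (List.pairwise_append.1 hp).2.1).1 y hy
        ⟨hlow b (by simp), hlt⟩
    cases l with
    | leaf u => exact ⟨(r.root, some u) :: L, by rw [root, cat, ← hL]⟩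
    | one b c => exact absurd hl.1 (key [] _ b rfl _ (root_mem_inorder c))
    | two b l' r' => exact absurd hl.1 (key _ _ b rfl _ (root_mem_inorder r'))

/-- By `hp`, letters below `u` precede those above it. The cut never separates a spine vertex from
its left sibling. -/
theorem exists_split_cat {a u : ℕ} {L : List (ℕ × Option ℕ)} (h : (cat a L).IsIncreasing)
    (hu : u ∉ catWord L) (hp : (catWord L).Pairwise fun y z => ¬ (z < u ∧ u < y)) :
    ∃ L₁ L₂, L = L₁ ++ L₂ ∧ (∀ y ∈ catWord L₁, y < u) ∧ ∀ y ∈ catWord L₂, u < y := by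
  induction L generalizing a with
  | nil => exact ⟨[], [], rfl, by simp [catWord], by simp [catWord]⟩
  | cons p L ih =>
    obtain ⟨x, _ | t⟩ := p
    · simp only [catWord, List.mem_cons, not_or, List.pairwise_cons] at hu hp
      have hx := root_cat_lt h.2
      rcases Ne.lt_or_gt hu.1 with hlt | hlt
      · refine ⟨[], _, rfl, by simp [catWord], fun y hy => ?_⟩
        rcases List.mem_cons.1 hy with rfl | hy
        · exact hlt
        · exact hlt.trans (hx y hy)
      · obtain ⟨L₁, L₂, rfl, h1, h2⟩ := ih h.2 hu.2 hp.2
        exact ⟨(x, none) :: L₁, L₂, rfl, by simpa [catWord] using ⟨hlt, h1⟩, h2⟩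
    · simp only [catWord, List.mem_cons, not_or, List.pairwise_cons] at hu hp
      have hx := root_cat_lt h.2.2.2
      have hxt : x < t := root_cat x L ▸ h.2.1
      rcases Ne.lt_or_gt hu.2.1 with hlt | hlt
      · refine ⟨[], _, rfl, by simp [catWord], fun y hy => ?_⟩
        simp only [catWord, List.mem_cons] at hy
        rcases hy with rfl | rfl | hy
        · exact hlt.trans hxt
        · exact hlt
        · exact hlt.trans (hx y hy)
      · obtain ⟨L₁, L₂, rfl, h1, h2⟩ := ih h.2.2.2 hu.2.2 hp.2.2
        -- In the word `t` precedes `x < u`, so `t > u` would contradict `hp`.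
        have ht : t < u := by
          have := hp.1 x (Or.inl rfl)
          omega
        exact ⟨(x, some t) :: L₁, L₂, rfl, by simpa [catWord] using ⟨ht, hlt, h1⟩, h2⟩

/-- Inversion of `code`: after an entry `(x, some u)`, the entries below `u` encode the right
subtree and those above `u` the left one. -/
theorem exists_code_eq {a : ℕ} {L : List (ℕ × Option ℕ)} (h : (cat a L).IsIncreasing)
    (hn : (catWord L).Nodup) (ha : Avoids231 (catWord L)) :
    ∃ S : Tree12, S.root = a ∧ code S = L ∧ S.preorder.Pairwise (· < ·) := by
  induction hk : L.length using Nat.strong_induction_on generalizing a L with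
  | _ k ih =>
    have hmem : ∀ {S : Tree12} {y : ℕ}, y ∈ S.preorder ↔ y = S.root ∨ y ∈ catWord (code S) :=
      fun {S y} => by rw [← (root_cons_catWord_code_perm S).mem_iff, List.mem_cons]
    rcases L with _ | ⟨⟨x, _ | u⟩, L⟩
    · exact ⟨leaf a, rfl, rfl, by simp [preorder]⟩
    · obtain ⟨S, rfl, rfl, hS⟩ := ih L.length (by simp [← hk]) h.2 (List.nodup_cons.1 hn).2
        (List.triplewise_cons.1 ha).2 rfl
      refine ⟨one a S, rfl, rfl, List.pairwise_cons.2 ⟨fun y hy => ?_, hS⟩⟩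
      exact root_cat_lt h y (hmem.1 hy |>.elim (fun e => by simp [catWord, e])
        fun e => by simp [catWord, e])
    · obtain ⟨hp, ha'⟩ := List.triplewise_cons.1 ha
      simp only [catWord, List.nodup_cons, List.mem_cons, not_or] at hn
      have hgt := root_cat_lt h
      have hxu : x < u := root_cat x L ▸ h.2.1
      have hinc := h.2.2.2
      obtain ⟨L₁, L₂, rfl, h1, h2⟩ := exists_split_cat (u := u) hinc hn.1.2
        (List.pairwise_cons.1 hp).2
      have ha'' := (List.triplewise_cons.1 ha').2
      rw [catWord_append] at ha'' hn
      obtain ⟨ha1, ha2, -, -⟩ := List.triplewise_append.1 ha''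
      obtain ⟨hn1, hn2, -⟩ := List.nodup_append.1 hn.2.2
      simp only [List.length_cons, List.length_append] at hk
      obtain ⟨r, hr, hr', hrs⟩ := ih L₁.length (by omega) (isIncreasing_cat_of_append_left hinc)
        hn1 ha1 rfl
      obtain ⟨l, hl, hl', hls⟩ := ih L₂.length (by omega)
        (isIncreasing_cat_of_append_right hinc h2) hn2 ha2 rfl
      refine ⟨two a l r, rfl, by simp [code, hr, hl, hr', hl'], ?_⟩
      simp only [preorder, List.pairwise_cons, List.pairwise_append, List.mem_append, hmem, hr,
        hl, hr', hl']
      refine ⟨fun y hy => hgt y ?_, hrs, hls, ?_⟩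
      · simp only [catWord, catWord_append, List.mem_cons, List.mem_append]
        tauto
      · rintro y (rfl | hy) z (rfl | hz)
        · exact hxu
        · exact hxu.trans (h2 z hz)
        · exact h1 y hy
        · exact (h1 y hy).trans (h2 z hz)

theorem exists_cat_code_eq {n : ℕ} {T : Tree12} (h : T ∈ Trees231 n) :
    ∃ S ∈ OrdTrees n, cat 0 (code S) = T := by
  obtain ⟨hT, ha⟩ := mem_trees231_iff.1 h
  obtain ⟨L, hL⟩ := exists_eq_cat hT.1 ha
  rw [root_eq_zero hT] at hL
  subst hL
  rw [phi_cat] at ha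
  have hp := (cons_catWord_perm 0 L).trans hT.2
  obtain ⟨S, h0, rfl, hs⟩ := exists_code_eq hT.1
    (List.nodup_cons.1 (hp.nodup_iff.2 List.nodup_range)).2 ha
  refine ⟨S, eq_range_of_sorted hs ((root_cons_catWord_code_perm S).symm.trans ?_), rfl⟩
  rwa [h0]

/-! ### Contexts -/

/-- One level of a tree with a hole: the hole is an only child, a left child or a right child. -/
inductive Frame : Type
  | only (a : ℕ) : Frame
  | left (a : ℕ) (r : Tree12) : Frame
  | right (a : ℕ) (l : Tree12) : Frame

/-- Fill the hole of a context, given from the hole up to the root. -/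
def fill : List Frame → Tree12 → Tree12
  | [], t => t
  | .only a :: C, t => fill C (one a t)
  | .left a r :: C, t => fill C (two a t r)
  | .right a l :: C, t => fill C (two a l t)

/-- The labels that precede the hole in right-to-left preorder. -/
def before : List Frame → List ℕ
  | [] => []
  | .only a :: C => before C ++ [a]
  | .left a r :: C => before C ++ a :: r.preorder
  | .right a _ :: C => before C ++ [a]

/-- The labels that follow the hole in right-to-left preorder. -/
def after : List Frame → List ℕ
  | [] => []
  | .only _ :: C => after C
  | .left _ _ :: C => after C
  | .right _ l :: C => l.preorder ++ after C

theorem preorder_fill (C : List Frame) (t : Tree12) :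
    (fill C t).preorder = before C ++ t.preorder ++ after C := by
  induction C generalizing t with
  | nil => simp [fill, before, after]
  | cons f C ih => cases f <;> simp [fill, before, after, ih, preorder]

theorem fill_append (C D : List Frame) (t : Tree12) : fill (C ++ D) t = fill D (fill C t) := by
  induction C generalizing t with
  | nil => rfl
  | cons f C ih => cases f <;> simp [fill, ih]

theorem subtree_eq_none {v : ℕ} {T : Tree12} (h : v ∉ T.preorder) : T.subtree v = none := by
  induction T with
  | leaf a => simp_all [subtree, preorder, eq_comm]
  | one a c ih => simp_all [subtree, preorder, eq_comm]
  | two a l r ihl ihr => simp_all [subtree, preorder, eq_comm]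

theorem replace_eq_self {v : ℕ} {T S : Tree12} (h : v ∉ T.preorder) : replace v S T = T := by
  induction T with
  | leaf a =>
    rw [preorder, List.mem_singleton] at h
    rw [replace, if_neg (Ne.symm h)]
  | one a c ih =>
    rw [preorder, List.mem_cons, not_or] at h
    rw [replace, if_neg (Ne.symm h.1), ih h.2]
  | two a l r ihl ihr =>
    rw [preorder, List.mem_cons, List.mem_append, not_or, not_or] at h
    rw [replace, if_neg (Ne.symm h.1), ihl h.2.2, ihr h.2.1]

theorem subtree_fill {v : ℕ} {C : List Frame} {t s : Tree12} (hb : v ∉ before C)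
    (ha : v ∉ after C) (h : t.subtree v = some s) : (fill C t).subtree v = some s := by
  induction C generalizing t with
  | nil => exact h
  | cons f C ih =>
    cases f with
    | only a =>
      simp only [before, after, List.mem_append, List.mem_cons, not_or, List.not_mem_nil,
        not_false_eq_true, and_true] at hb ha
      exact ih hb.1 ha (by simp [subtree, Ne.symm hb.2, h])
    | left a r =>
      simp only [before, after, List.mem_append, List.mem_cons, not_or] at hb ha
      exact ih hb.1 ha (by simp [subtree, Ne.symm hb.2.1, h])
    | right a l =>
      simp only [before, after, List.mem_append, List.mem_cons, not_or, List.not_mem_nil,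
        not_false_eq_true, and_true] at hb ha
      exact ih hb.1 ha.2 (by simp [subtree, Ne.symm hb.2, h, subtree_eq_none ha.1])

theorem replace_fill {v : ℕ} {C : List Frame} {t S : Tree12} (hb : v ∉ before C)
    (ha : v ∉ after C) : replace v S (fill C t) = fill C (replace v S t) := by
  induction C generalizing t with
  | nil => rfl
  | cons f C ih =>
    cases f with
    | only a =>
      simp only [before, after, List.mem_append, List.mem_cons, not_or, List.not_mem_nil,
        not_false_eq_true, and_true] at hb ha
      rw [fill, fill, ih hb.1 ha, replace, if_neg (Ne.symm hb.2)]
    | left a r =>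
      simp only [before, after, List.mem_append, List.mem_cons, not_or] at hb ha
      rw [fill, fill, ih hb.1 ha, replace, if_neg (Ne.symm hb.2.1), replace_eq_self hb.2.2]
    | right a l =>
      simp only [before, after, List.mem_append, List.mem_cons, not_or, List.not_mem_nil,
        not_false_eq_true, and_true] at hb ha
      rw [fill, fill, ih hb.1 ha.2, replace, if_neg (Ne.symm hb.2), replace_eq_self ha.1]

theorem subtree_root (T : Tree12) : T.subtree T.root = some T := by
  cases T <;> simp [subtree, root]

theorem replace_root (S T : Tree12) : replace T.root S T = S := by
  cases T <;> simp [replace, root]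

/-! ### Pending left subtrees -/

/-- Strip the left sibling of the hole of everything but its root. -/
def Frame.shear : Frame → Frame
  | .right a l => .right a (leaf l.root)
  | f => f

/-- The codes of the left siblings of a context, from the hole up to the root. -/
def pending : List Frame → List (ℕ × Option ℕ)
  | [] => []
  | .only _ :: C => pending C
  | .left _ _ :: C => pending C
  | .right _ l :: C => code l ++ pending C

theorem before_map_shear (C : List Frame) : before (C.map Frame.shear) = before C := by
  induction C with
  | nil => rfl
  | cons f C ih => cases f <;> simp [before, Frame.shear, ih]

theorem after_map_shear_subset (C : List Frame) : after (C.map Frame.shear) ⊆ after C := by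
  induction C with
  | nil => simp [after]
  | cons f C ih =>
    cases f with
    | only a => exact ih
    | left a r => exact ih
    | right a l =>
      intro x hx
      simp only [List.map_cons, Frame.shear, after, preorder, List.cons_append, List.nil_append,
        List.mem_cons, List.mem_append] at hx ⊢
      rcases hx with rfl | hx
      · exact Or.inl (root_mem_preorder l)
      · exact Or.inr (ih hx)

theorem pending_append (C D : List Frame) : pending (C ++ D) = pending C ++ pending D := by
  induction C with
  | nil => rfl
  | cons f C ih => cases f <;> simp [pending, ih]

theorem after_append (C D : List Frame) : after (C ++ D) = after C ++ after D := by
  induction C with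
  | nil => rfl
  | cons f C ih => cases f <;> simp [after, ih]

theorem code_eq_nil {T : Tree12} (h : code T = []) : T = leaf T.root := by
  cases T with
  | leaf a => rfl
  | one a c => simp [code] at h
  | two a l r => simp [code] at h

theorem map_shear_eq_self {C : List Frame} (h : pending C = []) : C.map Frame.shear = C := by
  induction C with
  | nil => rfl
  | cons f C ih =>
    cases f with
    | only a => exact congrArg _ (ih h)
    | left a r => exact congrArg _ (ih h)
    | right a l =>
      obtain ⟨h1, h2⟩ := List.append_eq_nil_iff.1 h
      rw [List.map_cons, ih h2, Frame.shear, ← code_eq_nil h1]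

/-- The nearest left sibling that is not a leaf is where the next round attaches the caterpillar. -/
theorem exists_first_pending {C : List Frame} (h : pending C ≠ []) :
    ∃ C₁ b l C₂, C = C₁ ++ .right b l :: C₂ ∧ pending C₁ = [] ∧ code l ≠ [] := by
  induction C with
  | nil => exact absurd rfl h
  | cons f C ih =>
    have key : ∀ f, pending [f] = [] → pending C ≠ [] →
        ∃ C₁ b l C₂, f :: C = C₁ ++ .right b l :: C₂ ∧ pending C₁ = [] ∧ code l ≠ [] := by
      intro f hf h
      obtain ⟨C₁, b, l, C₂, rfl, h1, h2⟩ := ih h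
      exact ⟨f :: C₁, b, l, C₂, rfl, by
        rw [← List.singleton_append, pending_append, hf, h1, List.nil_append], h2⟩
    cases f with
    | only a => exact key _ rfl h
    | left a r => exact key _ rfl h
    | right a l =>
      by_cases hl : code l = []
      · exact key _ (by simp [pending, hl]) (by simpa [pending, hl] using h)
      · exact ⟨[], a, l, C, rfl, rfl, hl⟩

/-! ### One round of switching -/

/-- In `List.range N` each letter equals its position. -/
theorem eq_range_of_append_cons {N x : ℕ} {A B : List ℕ} (h : A ++ x :: B = List.range N) :
    A = List.range x := by
  have hlen : A.length < N := by
    have := congrArg List.length h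
    simp only [List.length_append, List.length_cons, List.length_range] at this
    omega
  have hx : x = A.length := by
    have h1 : (A ++ x :: B)[A.length]? = some x := by simp
    rw [h, List.getElem?_range hlen] at h1
    exact (Option.some.inj h1).symm
  have h2 : (A ++ x :: B).take A.length = A := by simp
  rw [← h2, h, List.take_range, hx, min_eq_left hlen.le]

theorem firstGap_range' (s k z : ℕ) (w : List ℕ) (hz : s + k + 2 ≤ z) :
    firstGap (List.range' s k ++ (s + k) :: z :: w) = some (s + k, z) := by
  induction k generalizing s with
  | zero => simp only [List.range'_zero, List.nil_append, firstGap, if_pos hz]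
  | succ k ih =>
    have ih' := ih (s + 1) (by omega)
    rw [show s + 1 + k = s + (k + 1) by omega] at ih'
    rw [List.range'_succ, List.cons_append]
    rcases k with _ | k
    · rw [List.range'_zero, List.nil_append] at ih' ⊢
      rw [firstGap, if_neg (by omega), ih']
    · rw [List.range'_succ, List.cons_append] at ih' ⊢
      rw [firstGap, if_neg (by omega), ih']

theorem preorder_cat_cons (a z : ℕ) (o : Option ℕ) (M : List (ℕ × Option ℕ)) :
    ∃ w, (cat a ((z, o) :: M)).preorder = a :: z :: w := by
  have key : ∀ T : Tree12, ∃ w, T.preorder = T.root :: w := fun T => by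
    cases T <;> exact ⟨_, rfl⟩
  obtain ⟨w, hw⟩ := key (cat z M)
  rw [root_cat] at hw
  rcases o with _ | u
  · exact ⟨w, by rw [cat, preorder, hw]⟩
  · exact ⟨w ++ [u], by rw [cat, preorder, hw, preorder, List.cons_append]⟩

theorem preorder_of_code_ne_nil {T : Tree12} (h : code T ≠ []) :
    ∃ z o M w, code T = (z, o) :: M ∧ T.preorder = T.root :: z :: w := by
  have key : ∀ T : Tree12, ∃ w, T.preorder = T.root :: w := fun T => by
    cases T <;> exact ⟨_, rfl⟩
  cases T with
  | leaf a => exact absurd rfl h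
  | one a c =>
    obtain ⟨w, hw⟩ := key c
    exact ⟨_, _, _, w, rfl, by rw [preorder, hw, root]⟩
  | two a l r =>
    obtain ⟨w, hw⟩ := key r
    exact ⟨_, _, _, w ++ l.preorder, rfl, by rw [preorder, hw, root, List.cons_append]⟩

theorem switchSubtrees_of_subtree {v x : ℕ} {T : Tree12} {p : ℕ × Option ℕ}
    {M : List (ℕ × Option ℕ)} (h : T.subtree v = some (cat v (p :: M))) :
    switchSubtrees v x T = replace x (cat x (p :: M)) (replace v (leaf v) T) := by
  obtain ⟨z, _ | u⟩ := p <;> simp only [switchSubtrees, h, cat]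

/-- The current vertex `a` is a leaf of the target tree, and the caterpillar at `a` starts with the
code of `l`. Its first spine vertex `z` follows `l.root` in the target, so `z - 1 = l.root` is a
waiting leaf. The labels up to `a` are in place, so the first gap is `(a, z)`. -/
theorem switchRound_fill {N a b : ℕ} {l : Tree12} {C₁ C₂ : List Frame}
    (h : (fill (C₁ ++ .right b l :: C₂) (leaf a)).preorder = List.range N)
    (h₁ : pending C₁ = []) (hl : code l ≠ []) :
    ¬ (fill ((C₁ ++ .right b l :: C₂).map Frame.shear)
        (cat a (pending (C₁ ++ .right b l :: C₂)))).preorder.Pairwise (· < ·) ∧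
    switchRound (fill ((C₁ ++ .right b l :: C₂).map Frame.shear)
        (cat a (pending (C₁ ++ .right b l :: C₂)))) =
      fill ((.left b (fill C₁ (leaf a)) :: C₂).map Frame.shear)
        (cat l.root (code l ++ pending C₂)) := by
  obtain ⟨z, o, M, w, hc, hw⟩ := preorder_of_code_ne_nil hl
  have hpend : pending (C₁ ++ .right b l :: C₂) = (z, o) :: (M ++ pending C₂) := by
    rw [pending_append, h₁, pending, hc, List.nil_append, List.cons_append]
  have hfill : fill (C₁ ++ .right b l :: C₂) (leaf a) =
      fill (.left b (fill C₁ (leaf a)) :: C₂) l := by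
    rw [fill_append, fill, fill]
  have hl' : before (.left b (fill C₁ (leaf a)) :: C₂) ++ l.preorder ++ after C₂ =
      List.range N := by
    rw [← h, hfill, preorder_fill, after]
  have hnl : (before (.left b (fill C₁ (leaf a)) :: C₂) ++ l.preorder ++ after C₂).Nodup :=
    hl' ▸ List.nodup_range
  have hul := root_mem_preorder l
  have huB : l.root ∉ before (.left b (fill C₁ (leaf a)) :: C₂) := fun hm =>
    (List.nodup_append.1 (List.nodup_append.1 hnl).1).2.2 _ hm _ hul rfl
  have huA : l.root ∉ after C₂ := fun hm =>
    (List.nodup_append.1 hnl).2.2 _ (List.mem_append_right _ hul) _ hm rfl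
  have hz : z = l.root + 1 := by
    rw [hw] at hl'
    have e1 := eq_range_of_append_cons (A := before (.left b (fill C₁ (leaf a)) :: C₂))
      (x := l.root) (B := z :: w ++ after C₂) (by simpa using hl')
    have e2 := eq_range_of_append_cons
      (A := before (.left b (fill C₁ (leaf a)) :: C₂) ++ [l.root]) (x := z)
      (B := w ++ after C₂) (by simpa using hl')
    have := congrArg List.length e2
    rw [e1] at this
    simpa using this.symm
  generalize hC : C₁ ++ .right b l :: C₂ = C at *
  rw [preorder_fill, preorder] at h
  have hB : before C = List.range a := eq_range_of_append_cons (B := after C) (by simpa using h)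
  have hsort : (before C ++ [a] ++ after C).Pairwise (· < ·) := h ▸ List.pairwise_lt_range
  have hAlt : ∀ y ∈ after C, a < y := fun y hy =>
    (List.pairwise_append.1 hsort).2.2 a (by simp) y hy
  have huC : l.root ∈ after (C.map Frame.shear) := by
    rw [← hC, List.map_append, after_append]
    simp [Frame.shear, after, preorder]
  have hau := hAlt _ (after_map_shear_subset C huC)
  have haB : a ∉ before (C.map Frame.shear) := by rw [before_map_shear, hB]; simp
  have haA : a ∉ after (C.map Frame.shear) := fun hm =>
    (hAlt a (after_map_shear_subset C hm)).false
  obtain ⟨w', hw'⟩ := preorder_cat_cons a z o (M ++ pending C₂)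
  have hpre : (fill (C.map Frame.shear) (cat a (pending C))).preorder =
      List.range a ++ a :: z :: (w' ++ after (C.map Frame.shear)) := by
    rw [preorder_fill, hpend, hw', before_map_shear, hB]
    simp
  constructor
  · rw [hpre]
    intro hs
    have h1 := (List.pairwise_cons.1 (List.pairwise_append.1 hs).2.1).2
    -- The waiting leaf `l.root = z - 1` comes after `z` in this preorder.
    have := (List.pairwise_cons.1 h1).1 l.root (List.mem_append_right _ huC)
    omega
  · have hgap : firstGap (fill (C.map Frame.shear) (cat a (pending C))).preorder =
        some (a, z) := by
      have := firstGap_range' 0 a z (w' ++ after (C.map Frame.shear)) (by omega)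
      rw [hpre, List.range_eq_range']
      simpa using this
    have hsub : (fill (C.map Frame.shear) (cat a (pending C))).subtree a =
        some (cat a ((z, o) :: (M ++ pending C₂))) := by
      refine subtree_fill haB haA ?_
      have := subtree_root (cat a (pending C))
      rw [root_cat] at this
      rw [this, hpend]
    have hrep : replace a (leaf a) (cat a (pending C)) = leaf a := by
      have := replace_root (leaf a) (cat a (pending C))
      rwa [root_cat] at this
    -- With the caterpillar removed, the same tree is viewed with its hole at `l.root` instead of
    -- `a`; no code is pending in `C₁`, so shearing leaves it unchanged.
    have hleaf : fill (C.map Frame.shear) (leaf a) =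
        fill ((.left b (fill C₁ (leaf a)) :: C₂).map Frame.shear) (leaf l.root) := by
      rw [← hC, List.map_append, map_shear_eq_self h₁, fill_append]
      rfl
    rw [switchRound, hgap]
    change switchSubtrees a (z - 1) _ = _
    rw [switchSubtrees_of_subtree hsub, replace_fill haB haA, hrep, hleaf,
      show z - 1 = l.root by omega,
      replace_fill (C := (Frame.left b (fill C₁ (leaf a)) :: C₂).map Frame.shear)
        (by rw [before_map_shear]; exact huB) fun hm => huA (after_map_shear_subset C₂ hm),
      hc]
    exact congrArg _ (replace_root _ (leaf l.root))

/-! ### Switching turns the caterpillar of an ordered tree into that tree -/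

/-- The invariant of the process, by induction on the number of target labels from the hole onwards.
Passing to an only or right child merely re-reads the same tree; a round is spent only when the hole
holds a leaf and codes are pending. -/
theorem exists_iterate_switchRound {N : ℕ} {C : List Frame} {S : Tree12}
    (h : (fill C S).preorder = List.range N) :
    ∃ k, switchRound^[k] (fill (C.map Frame.shear) (cat S.root (code S ++ pending C))) =
        fill C S ∧
      ∀ j < k, ¬ (switchRound^[j] (fill (C.map Frame.shear)
        (cat S.root (code S ++ pending C)))).preorder.Pairwise (· < ·) := by
  induction hk : S.preorder.length + (after C).length using Nat.strong_induction_on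
    generalizing C S with
  | _ k ih =>
    cases S with
    | one a c =>
      exact ih (c.preorder.length + (after C).length)
        (by simp only [preorder, List.length_cons] at hk; omega)
        (C := .only a :: C) (S := c) h rfl
    | two a l r =>
      have := ih (r.preorder.length + (l.preorder ++ after C).length)
        (by simp only [preorder, List.length_cons, List.length_append] at hk ⊢; omega)
        (C := .right a l :: C) (S := r) h rfl
      simpa only [List.map_cons, Frame.shear, fill, pending, root, code, List.cons_append, cat,
        List.append_assoc] using this
    | leaf a =>
      by_cases hp : pending C = []
      · refine ⟨0, ?_, by simp⟩
        rw [map_shear_eq_self hp, hp]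
        rfl
      · obtain ⟨C₁, b, l, C₂, rfl, h1, h2⟩ := exists_first_pending hp
        obtain ⟨hns, hround⟩ := switchRound_fill h h1 h2
        have hfill : fill (C₁ ++ .right b l :: C₂) (leaf a) =
            fill (.left b (fill C₁ (leaf a)) :: C₂) l := by
          rw [fill_append, fill, fill]
        obtain ⟨m, hm, hm'⟩ := ih (l.preorder.length + (after C₂).length)
          (by
            simp only [preorder, List.length_cons, List.length_nil, after_append, after,
              List.length_append] at hk
            omega) (C := .left b (fill C₁ (leaf a)) :: C₂) (S := l) (hfill ▸ h) rfl
        rw [pending, ← hround] at hm hm'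
        refine ⟨m + 1, hm.trans hfill.symm, fun j hj => ?_⟩
        rcases j with _ | j
        · exact hns
        · exact hm' j (by omega)

theorem psi_cat_code {n : ℕ} {S : Tree12} (h : S ∈ OrdTrees n) : psi (cat 0 (code S)) = S := by
  have h0 := root_eq_zero (mem_ordTrees_iff.1 h).1
  obtain ⟨k, hk, hj⟩ := exists_iterate_switchRound (C := []) (S := S) h
  simp only [List.map_nil, fill, pending, List.append_nil, h0] at hk hj
  have hmem : k ∈ {k : ℕ | (switchRound^[k] (cat 0 (code S))).preorder.Pairwise (· < ·)} := by
    rw [Set.mem_ofPred_eq, hk]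
    exact (mem_ordTrees_iff.1 h).2
  have hinf : sInf {k : ℕ | (switchRound^[k] (cat 0 (code S))).preorder.Pairwise (· < ·)} = k :=
    -- No earlier iterate is sorted, so `psi` stops exactly at round `k`.
    le_antisymm (Nat.sInf_le hmem) (not_lt.1 fun hlt => hj _ hlt (Nat.sInf_mem ⟨k, hmem⟩))
  rw [psi, hinf, hk]

/-- The map `S ↦ cat 0 (code S)` is onto `Trees231 n` and `psi` is a left inverse of it, so `psi` is
bijective. -/
theorem psi_bijOn (n : ℕ) : BijOn psi (Trees231 n) (OrdTrees n) := by
  refine ⟨fun T hT => ?_, fun T hT T' hT' h => ?_, fun S hS => ?_⟩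
  · obtain ⟨S, hS, rfl⟩ := exists_cat_code_eq hT
    rwa [psi_cat_code hS]
  · obtain ⟨S, hS, rfl⟩ := exists_cat_code_eq hT
    obtain ⟨S', hS', rfl⟩ := exists_cat_code_eq hT'
    rw [psi_cat_code hS, psi_cat_code hS'] at h
    rw [h]
  · exact ⟨_, cat_code_mem_trees231 hS, psi_cat_code hS⟩

/-! ### The map `χ` -/

theorem length_chi (T : Tree12) : (chi T).length + 1 = T.preorder.length := by
  induction T with
  | leaf a => rfl
  | one a c ih => simp [chi, preorder, ih]
  | two a l r ihl ihr =>
    simp only [chi, preorder, List.length_cons, List.length_append]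
    omega

/-- Unique parsing: a remainder that is empty or starts with `D` marks where the word of the tree
ends. The word fixes the shape, and equal preorders then fix the labels. -/
theorem eq_of_chi_append_eq {T T' : Tree12} {X X' : List Step}
    (hX : X = [] ∨ ∃ Y, X = Step.D :: Y) (hX' : X' = [] ∨ ∃ Y, X' = Step.D :: Y)
    (h : chi T ++ X = chi T' ++ X') :
    X = X' ∧ T.preorder.length = T'.preorder.length ∧ (T.preorder = T'.preorder → T = T') := by
  induction T generalizing T' X X' with
  | leaf a =>
    cases T' with
    | leaf a' => exact ⟨h, rfl, by simp [preorder]⟩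
    | one a' c' => rcases hX with rfl | ⟨Y, rfl⟩ <;> simp [chi] at h
    | two a' l' r' => rcases hX with rfl | ⟨Y, rfl⟩ <;> simp [chi] at h
  | one a c ih =>
    cases T' with
    | leaf a' => rcases hX' with rfl | ⟨Y, rfl⟩ <;> simp [chi] at h
    | one a' c' =>
      obtain ⟨h1, h2, h3⟩ := ih hX hX' (List.cons.inj h).2
      refine ⟨h1, by simp [preorder, h2], fun h4 => ?_⟩
      obtain ⟨rfl, h5⟩ := List.cons.inj h4
      rw [h3 h5]
    | two a' l' r' => simp [chi] at h
  | two a l r ihl ihr =>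
    cases T' with
    | leaf a' => rcases hX' with rfl | ⟨Y, rfl⟩ <;> simp [chi] at h
    | one a' c' => simp [chi] at h
    | two a' l' r' =>
      simp only [chi, List.cons_append, List.append_assoc, List.cons.injEq, true_and] at h
      obtain ⟨h1, h2, h3⟩ := ihr (Or.inr ⟨_, rfl⟩) (Or.inr ⟨_, rfl⟩) h
      obtain ⟨h4, h5, h6⟩ := ihl hX hX' (List.cons.inj h1).2
      refine ⟨h4, by simp [preorder, h2, h5], fun h7 => ?_⟩
      obtain ⟨rfl, h8⟩ := List.cons.inj h7
      obtain ⟨h9, h10⟩ := List.append_inj h8 h2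
      rw [h3 h9, h6 h10]

/-- The path with the steps `p` starts at height `h`, ends at height `0` and never passes below
the axis. -/
def StaysAbove (h : ℤ) (p : List Step) : Prop :=
  h + (p.map Step.rise).sum = 0 ∧ ∀ k, 0 ≤ h + ((p.take k).map Step.rise).sum

theorem staysAbove_nil {h : ℤ} : StaysAbove h [] ↔ h = 0 := by
  simp only [StaysAbove, List.map_nil, List.sum_nil, add_zero, List.take_nil]
  exact ⟨fun h => h.1, fun h => ⟨h, fun _ => h.ge⟩⟩

theorem staysAbove_cons {h : ℤ} {s : Step} {p : List Step} :
    StaysAbove h (s :: p) ↔ 0 ≤ h ∧ StaysAbove (h + s.rise) p := by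
  simp only [StaysAbove, List.map_cons, List.sum_cons, add_assoc]
  constructor
  · rintro ⟨h1, h2⟩
    refine ⟨by simpa using h2 0, h1, fun k => ?_⟩
    simpa using h2 (k + 1)
  · rintro ⟨h0, h1, h2⟩
    refine ⟨h1, fun k => ?_⟩
    rcases k with _ | k
    · simpa using h0
    · simpa using h2 k

theorem StaysAbove.nonneg {h : ℤ} {p : List Step} (hp : StaysAbove h p) : 0 ≤ h := by
  simpa using hp.2 0

theorem staysAbove_append {h k : ℤ} {p q : List Step} (hp : StaysAbove h p)
    (hq : StaysAbove k q) : StaysAbove (h + k) (p ++ q) := by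
  induction p generalizing h with
  | nil =>
    rw [staysAbove_nil] at hp
    simpa [hp] using hq
  | cons s p ih =>
    have hk := hq.nonneg
    rw [staysAbove_cons] at hp
    rw [List.cons_append, staysAbove_cons]
    refine ⟨by omega, ?_⟩
    rw [show h + k + s.rise = h + s.rise + k by ring]
    exact ih hp.2

/-- The cut is at the first step from height `k + 1` down to `k`; before it the path stays at or
above `k + 1`, so `h` measures the height over that level. -/
theorem exists_first_descent {h k : ℤ} {p : List Step} (hh : 0 ≤ h) (hk : 0 ≤ k)
    (hp : StaysAbove (h + (k + 1)) p) :
    ∃ q s, p = q ++ Step.D :: s ∧ StaysAbove h q ∧ StaysAbove k s := by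
  induction p generalizing h with
  | nil =>
    rw [staysAbove_nil] at hp
    omega
  | cons s p ih =>
    rw [staysAbove_cons] at hp
    by_cases h0 : 0 ≤ h + s.rise
    · obtain ⟨q, t, rfl, hq, ht⟩ := ih h0 (by
        rw [show h + s.rise + (k + 1) = h + (k + 1) + s.rise by ring]; exact hp.2)
      exact ⟨s :: q, t, rfl, staysAbove_cons.2 ⟨hh, hq⟩, ht⟩
    · cases s with
      | U => simp only [Step.rise] at h0; omega
      | L => simp only [Step.rise] at h0; omega
      | D =>
        simp only [Step.rise] at h0 hp
        obtain rfl : h = 0 := by omega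
        refine ⟨[], p, rfl, staysAbove_nil.2 rfl, ?_⟩
        simpa using hp.2

theorem staysAbove_chi (T : Tree12) : StaysAbove 0 (chi T) := by
  induction T with
  | leaf a => exact staysAbove_nil.2 rfl
  | one a c ih => exact staysAbove_cons.2 ⟨le_rfl, by simpa [Step.rise] using ih⟩
  | two a l r ihl ihr =>
    refine staysAbove_cons.2 ⟨le_rfl, ?_⟩
    have : StaysAbove 1 (Step.D :: chi l) :=
      staysAbove_cons.2 ⟨by simp, by simpa [Step.rise] using ihl⟩
    simpa [Step.rise] using staysAbove_append ihr this

theorem exists_chi_eq {p : List Step} (hp : StaysAbove 0 p) (a : ℕ) :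
    ∃ T : Tree12, T.preorder = List.range' a (p.length + 1) ∧ chi T = p := by
  induction hk : p.length using Nat.strong_induction_on generalizing p a with
  | _ k ih =>
    rcases p with _ | ⟨s, p⟩
    · subst hk
      exact ⟨leaf a, rfl, rfl⟩
    rw [List.length_cons] at hk
    rw [staysAbove_cons] at hp
    cases s with
    | U =>
      obtain ⟨q, s, rfl, hq, hs⟩ := exists_first_descent (h := 0) (k := 0) le_rfl le_rfl hp.2
      simp only [List.length_append, List.length_cons] at hk
      obtain ⟨r, hr, rfl⟩ := ih q.length (by omega) hq (a + 1) rfl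
      -- The right subtree comes first in preorder and uses `(chi r).length + 1` labels after the
      -- root.
      obtain ⟨l, hl, rfl⟩ := ih s.length (by omega) hs (a + 1 + ((chi r).length + 1)) rfl
      refine ⟨two a l r, ?_, rfl⟩
      rw [preorder, hr, hl, List.range'_append_1, ← List.range'_succ, ← hk]
      congr 1
      omega
    | L =>
      obtain ⟨c, hc, rfl⟩ := ih p.length (by omega) (by simpa [Step.rise] using hp.2) (a + 1) rfl
      exact ⟨one a c, by rw [preorder, hc, ← hk, ← List.range'_succ], rfl⟩
    | D =>
      have := hp.2.nonneg
      simp [Step.rise] at this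

theorem mem_motzkinPaths_iff {n : ℕ} {p : List Step} :
    p ∈ MotzkinPaths n ↔ p.length = n ∧ StaysAbove 0 p := by
  simp only [MotzkinPaths, StaysAbove, Set.mem_ofPred_eq, zero_add]

theorem chi_bijOn (n : ℕ) : BijOn chi (OrdTrees n) (MotzkinPaths n) := by
  refine ⟨fun T hT => ?_, fun T hT T' hT' h => ?_, fun p hp => ?_⟩
  · refine mem_motzkinPaths_iff.2 ⟨?_, staysAbove_chi T⟩
    have h1 := length_chi T
    rw [show T.preorder = List.range (n + 1) from hT, List.length_range] at h1
    omega
  · have e : T.preorder = T'.preorder :=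
      Eq.trans (show T.preorder = List.range (n + 1) from hT) (Eq.symm hT')
    exact (eq_of_chi_append_eq (X := []) (X' := []) (Or.inl rfl) (Or.inl rfl)
      (by simpa using h)).2.2 e
  · obtain ⟨h1, h2⟩ := mem_motzkinPaths_iff.1 hp
    obtain ⟨T, hT, rfl⟩ := exists_chi_eq h2 0
    refine ⟨T, ?_, rfl⟩
    change T.preorder = List.range (n + 1)
    rw [hT, h1, List.range_eq_range']

/-! ### The composite bijections -/

theorem phiInv_bijOn (n : ℕ) :
    BijOn (phiInv n) (oneLine '' RSAvoid n ![2, 3, 1]) (Trees231 n) := by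
  have hb := phi_bijOn_trees231 n
  have hinv : ∀ T ∈ Trees231 n, phiInv n (phi T) = T := fun T hT =>
    (phi_bijOn n).injOn.leftInvOn_invFunOn hT.1
  refine ⟨?_, ?_, fun T hT => ⟨phi T, hb.mapsTo hT, hinv T hT⟩⟩
  · intro w hw
    obtain ⟨T, hT, rfl⟩ := hb.surjOn hw
    rwa [hinv T hT]
  · intro w hw w' hw' h
    obtain ⟨T, hT, rfl⟩ := hb.surjOn hw
    obtain ⟨T', hT', rfl⟩ := hb.surjOn hw'
    rw [hinv T hT, hinv T' hT'] at h
    rw [h]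

/-- Pulls a bijection onto words back to permutations through the injective `oneLine`. -/
theorem exists_equiv_of_bijOn {α β γ : Type*} {s : Set α} {t : Set β} {f : α → γ} {g : β → γ}
    (hg : Function.Injective g) (h : BijOn f s (g '' t)) :
    ∃ e : s ≃ t, ∀ x, g (e x).1 = f x.1 := by
  refine ⟨h.equiv f |>.trans (Equiv.Set.image g t hg).symm, fun x => ?_⟩
  have := congrArg Subtype.val
    ((Equiv.Set.image g t hg).apply_symm_apply (h.equiv f x))
  exact this

theorem psi_phiInv_oneLine_bijOn (n : ℕ) :
    BijOn (fun σ : Equiv.Perm (Fin n) => psi (phiInv n (oneLine σ)))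
      (RSAvoid n ![2, 3, 1]) (OrdTrees n) :=
  (psi_bijOn n).comp ((phiInv_bijOn n).comp oneLine_injective.injOn.bijOn_image)

end Simsun

theorem mainTheorem7 (n : ℕ) :
    -- `φ` is a bijection from increasing 1-2 trees onto simsun permutations,
    -- so that `phiInv n` is its inverse
    Set.BijOn Simsun.phi (Simsun.IncTrees n) (Simsun.oneLine '' Simsun.RS n) ∧
    -- `ψ` is a bijection between the two families of trees; in particular switching terminates
    Set.BijOn Simsun.psi (Simsun.Trees231 n) (Simsun.OrdTrees n) ∧
    -- `φ ∘ ψ ∘ φ⁻¹` is a bijection from `RS_n(231)` to `RS_n(213)`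
    (∃ e : Simsun.RSAvoid n ![2, 3, 1] ≃ Simsun.RSAvoid n ![2, 1, 3],
      ∀ σ, Simsun.oneLine (e σ).1 =
        Simsun.phi (Simsun.psi (Simsun.phiInv n (Simsun.oneLine σ.1)))) ∧
    -- `χ ∘ ψ ∘ φ⁻¹` is a bijection from `RS_n(231)` to Motzkin paths of length `n`
    (∃ e : Simsun.RSAvoid n ![2, 3, 1] ≃ Simsun.MotzkinPaths n,
      ∀ σ, (e σ).1 =
        Simsun.chi (Simsun.psi (Simsun.phiInv n (Simsun.oneLine σ.1)))) := by
  refine ⟨Simsun.phi_bijOn n, Simsun.psi_bijOn n, ?_, ?_⟩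
  · exact Simsun.exists_equiv_of_bijOn Simsun.oneLine_injective
      ((Simsun.phi_bijOn_ordTrees n).comp (Simsun.psi_phiInv_oneLine_bijOn n))
  · refine Simsun.exists_equiv_of_bijOn (g := id)
      (f := fun σ => Simsun.chi (Simsun.psi (Simsun.phiInv n (Simsun.oneLine σ))))
      Function.injective_id ?_
    rw [Set.image_id]
    exact (Simsun.chi_bijOn n).comp (Simsun.psi_phiInv_oneLine_bijOn n)
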